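/- **Notation.** All vector spaces are over $\mathbb{C}$, $i=\sqrt{-1}$, and $s\in\mathbb{C}$ is fixed. * $\mathcal{M}_s$ is the Fock space of the $\beta\gamma$ fields $\beta(z)=\sum_{n\in\mathbb Z}\beta(n)z^{-n+s}$, $\gamma(z)=\sum_{n\in\mathbb Z}\gamma(n)z^{-n-s-1}$, with $[\gamma(m),\beta(n)]=\delta_{m,-n}$, $[\beta(m),\beta(n)]=[\gamma(m),\gamma(n)]=0$, generated by a vacuum vector $|s\rangle$ with $\beta(n+1)|s\rangle=\gamma(n)|s\rangle=0$ for $n\ge 0$. For $l\in\mathbb Z$, $\mathcal{M}_s^l\subset\mathcal M_s$ is the subspace of $\beta\gamma$-charge $l$, i.e. the eigenspace of $-\sum_{k\in\mathbb Z}:\!\gamma(-k)\beta(k)\!:$ with eigenvalue $l$. (Thus $\beta(n)$ has charge $-1$, $\gamma(n)$ has charge $+1$, $|s\rangle$ has charge $0$.) * $\mathcal F$ is the Fock space of the fermionic fields $b(z)=\sum_n b(n)z^{-n}$, $c(z)=\sum_n c(n)z^{-n-1}$, with $[b(m),c(n)]_+=\delta_{m,-n}$, $[b(m),b(n)]_+=[c(m),c(n)]_+=0$,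 generated by a vacuum vector $|bc\rangle$ with $b(n+1)|bc\rangle=c(n)|bc\rangle=0$ for $n\ge0$. $\mathcal F^l\subset\mathcal F$ is the eigenspace of $j^{bc}_0=\sum_{k\in\mathbb Z}:\!c(-k)b(k)\!:$ with eigenvalue $l\in\mathbb Z$, and $\overline{\mathcal F}^{\,l}$ is the kernel of $c(0):\mathcal F^l\to\mathcal F^{l+1}$. * For $\alpha\in\mathbb C$, $\mathcal H_\alpha$ is the Fock space of the Heisenberg algebra $[j(m),j(n)]=m\delta_{m,-n}$, generated by a vacuum vector $|\alpha\rangle$ with $j(n)|\alpha\rangle=\alpha\delta_{n,0}|\alpha\rangle$ for $n\ge 0$. For $\eta\in\mathbb C$, $e^{\eta q}:\mathcal H_\alpha\to\mathcal H_{\alpha+\eta}$ is the linear map commuting with $j(n)$, $n\ne0$, and sending $|\alpha\rangle$ to $|\alpha+\eta\rangle$, and, on $\mathcal H_\alpha$, $$X_\eta(z)=e^{\eta q}z^{\eta\alpha}\exp\Big(\eta\sum_{n>0}\frac{j(-n)}{n}z^n\Big)\exp\Big(\eta\sum_{n<0}\frac{j(-n)}{n}z^n\Big).$$ * $N(s)=\bigoplus_{l\in\mathbb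 Z}\mathcal F^l\otimes\mathcal H_{i(s+l)}$. Operators $\beta(n),\gamma(n)$ $(n\in\mathbb Z)$ on $N(s)$ are defined by $$\sum_{n}\beta(n)z^{-n+s}=\partial b(z)\,X_{-i}(z),\qquad \sum_{n}\gamma(n)z^{-n-s-1}=c(z)\,X_i(z).$$ The operator $c(0)$, acting on the first tensor factors, maps $\mathcal F^l\otimes\mathcal H_{i(s+l)}$ to $\mathcal F^{l+1}\otimes\mathcal H_{i(s+l)}$, so $c(0):N(s)\to N(s-1)$. **Proposition.** Let $s\in\mathbb C$. 1. The operators $\beta(n),\gamma(n)$ on $N(s)$ satisfy $[\gamma(m),\beta(n)]=\delta_{m,-n}$ and $[\beta(m),\beta(n)]=[\gamma(m),\gamma(n)]=0$ for all $m,n\in\mathbb Z$. 2. There is a unique linear map $\epsilon:\mathcal M_s\to N(s)$ that commutes with all $\beta(n),\gamma(n)$, $n\in\mathbb Z$, and satisfies $\epsilon(|s\rangle)=|bc\rangle\otimes|is\rangle$. It is injective. 3. The image of $\epsilon$ is exactly the kernel of $c(0):N(s)\to N(s-1)$. 4. For every $l\in\mathbb Z$, $\epsilon$ restricts to an isomorphism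 of $\mathcal M_s^l$ onto $\overline{\mathcal F}^{\,l}\otimes\mathcal H_{i(s+l)}\subset\mathcal F^l\otimes\mathcal H_{i(s+l)}\subset N(s)$; thus $\mathcal M_s^l\cong\overline{\mathcal F}^{\,l}\otimes\mathcal H_{i(s+l)}$. -/

import Mathlib

open scoped TensorProduct

noncomputable section

namespace FMS

/-! ### Locally finite sums of operators -/

/-- The sum `∑ i, f i` of a family of linear maps which is locally finite, i.e. for every vector `v`
only finitely many of the `f i v` are nonzero. -/
def locFinSum {ι V W : Type} [AddCommMonoid V] [Module ℂ V] [AddCommMonoid W] [Module ℂ W]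
    (f : ι → V →ₗ[ℂ] W) (hf : ∀ v, (Function.support fun i => f i v).Finite) : V →ₗ[ℂ] W where
  toFun v := ∑ᶠ i, f i v
  map_add' v w := by
    simp only [map_add]
    exact finsum_add_distrib (hf v) (hf w)
  map_smul' a v := by
    simp only [map_smul, RingHom.id_apply]
    exact ((DistribSMul.toAddMonoidHom W a).map_finsum (hf v)).symm

theorem locFinSum_apply {ι V W : Type} [AddCommMonoid V] [Module ℂ V] [AddCommMonoid W]
    [Module ℂ W] (f : ι → V →ₗ[ℂ] W) (hf : ∀ v, (Function.support fun i => f i v).Finite) (v : V) :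
    locFinSum f hf v = ∑ᶠ i, f i v := rfl

/-! ### The `βγ` Fock space

Polynomials in the creation operators: the variable `inl k` is `β(-k)` and the variable `inr k`
is `γ(-k-1)`, `k ≥ 0`.  The vacuum vector is `1`. -/

/-- The Fock space of the `βγ` fields. -/
abbrev BGFock : Type := MvPolynomial (ℕ ⊕ ℕ) ℂ

/-- The vacuum vector of the `βγ` Fock space. -/
def bgVac : BGFock := 1

/-- The mode `β(n)`. -/
def betaMode (n : ℤ) : Module.End ℂ BGFock :=
  if n ≤ 0 then LinearMap.mulLeft ℂ (MvPolynomial.X (Sum.inl (-n).toNat))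
  else -(MvPolynomial.pderiv (Sum.inr (n - 1).toNat)).toLinearMap

/-- The mode `γ(n)`. -/
def gammaMode (n : ℤ) : Module.End ℂ BGFock :=
  if n < 0 then LinearMap.mulLeft ℂ (MvPolynomial.X (Sum.inr (-n - 1).toNat))
  else (MvPolynomial.pderiv (Sum.inl n.toNat)).toLinearMap

/-- The normally ordered product `:γ(-k) β(k):` (operators annihilating the vacuum stand on the
right). -/
def bgNormal (k : ℤ) : Module.End ℂ BGFock :=
  if 1 ≤ k then gammaMode (-k) * betaMode k else betaMode k * gammaMode (-k)

theorem bgNormal_finite (v : BGFock) : (Function.support fun k => bgNormal k v).Finite := by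
  classical
  refine ((v.vars.finite_toSet).image
    (Sum.elim (fun k : ℕ => -(k : ℤ)) (fun k : ℕ => (k : ℤ) + 1))).subset ?_
  intro k hk
  rw [Function.mem_support] at hk
  by_contra hcon
  apply hk
  unfold bgNormal
  split_ifs with h
  · have h1 : Sum.inr (k - 1).toNat ∉ v.vars := fun hm => hcon ⟨_, hm, by simp; omega⟩
    have h2 : ¬ k ≤ 0 := by omega
    have h3 : betaMode k v = 0 := by
      rw [betaMode, if_neg h2]
      change -(MvPolynomial.pderiv (Sum.inr (k - 1).toNat) v) = 0
      rw [MvPolynomial.pderiv_eq_zero_of_notMem_vars h1, neg_zero]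
    rw [Module.End.mul_apply, h3, map_zero]
  · have h1 : Sum.inl (-k).toNat ∉ v.vars := fun hm => hcon ⟨_, hm, by simp; omega⟩
    have h2 : ¬ -k < 0 := by omega
    have h3 : gammaMode (-k) v = 0 := by
      rw [gammaMode, if_neg h2]
      exact MvPolynomial.pderiv_eq_zero_of_notMem_vars h1
    rw [Module.End.mul_apply, h3, map_zero]

/-- The zero mode `∑_k :γ(-k) β(k):` of the field `:γ(z) β(z):`. -/
def bgCurrentZero : Module.End ℂ BGFock := locFinSum bgNormal bgNormal_finite

/-- The subspace of `βγ`-charge `l`: the eigenspace of minus the zero mode of `:γ(z) β(z):`. -/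
def bgCharge (l : ℤ) : Submodule ℂ BGFock := Module.End.eigenspace (-bgCurrentZero) (l : ℂ)

/-! ### The `bc` Fock space

The exterior algebra on the creation operators: the basis vector `inl k` is `b(-k)` and the basis
vector `inr k` is `c(-k-1)`, `k ≥ 0`.  The vacuum vector is `1`. -/

/-- The Fock space `F` of the `bc` fields. -/
abbrev BCFock : Type := ExteriorAlgebra ℂ ((ℕ ⊕ ℕ) →₀ ℂ)

/-- The vacuum vector of the `bc` Fock space. -/
def bcVac : BCFock := 1

/-- Left multiplication by a generator. -/
def bcCreate (x : ℕ ⊕ ℕ) : Module.End ℂ BCFock :=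
  LinearMap.mulLeft ℂ (ExteriorAlgebra.ι ℂ (Finsupp.single x 1))

/-- Contraction with (the odd derivation dual to) a generator. -/
def bcAnnih (x : ℕ ⊕ ℕ) : Module.End ℂ BCFock :=
  CliffordAlgebra.contractLeft (Finsupp.lapply x : ((ℕ ⊕ ℕ) →₀ ℂ) →ₗ[ℂ] ℂ)

/-- The mode `b(n)`. -/
def bMode (n : ℤ) : Module.End ℂ BCFock :=
  if n ≤ 0 then bcCreate (Sum.inl (-n).toNat) else bcAnnih (Sum.inr (n - 1).toNat)

/-- The mode `c(n)`. -/
def cMode (n : ℤ) : Module.End ℂ BCFock :=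
  if n < 0 then bcCreate (Sum.inr (-n - 1).toNat) else bcAnnih (Sum.inl n.toNat)

theorem bcCreate_anticomm (x y : ℕ ⊕ ℕ) : bcCreate x * bcCreate y + bcCreate y * bcCreate x = 0 := by
  refine LinearMap.ext fun v => ?_
  simp only [bcCreate, LinearMap.add_apply, Module.End.mul_apply, LinearMap.mulLeft_apply,
    LinearMap.zero_apply]
  rw [← mul_assoc, ← mul_assoc, ← add_mul, ExteriorAlgebra.ι_add_mul_swap, zero_mul]

theorem bcAnnih_anticomm (x y : ℕ ⊕ ℕ) : bcAnnih x * bcAnnih y + bcAnnih y * bcAnnih x = 0 := by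
  refine LinearMap.ext fun v => ?_
  simp only [bcAnnih, LinearMap.add_apply, Module.End.mul_apply, LinearMap.zero_apply]
  rw [CliffordAlgebra.contractLeft_comm, neg_add_cancel]

theorem bcAnnih_create (x y : ℕ ⊕ ℕ) :
    bcAnnih x * bcCreate y + bcCreate y * bcAnnih x = if x = y then 1 else 0 := by
  classical
  refine LinearMap.ext fun v => ?_
  simp only [bcAnnih, bcCreate, LinearMap.add_apply, Module.End.mul_apply, LinearMap.mulLeft_apply,
    ExteriorAlgebra.ι]
  rw [CliffordAlgebra.contractLeft_ι_mul]
  by_cases h : x = y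
  · simp [h]
  · simp [h]

theorem bMode_anticomm (m n : ℤ) : bMode m * bMode n + bMode n * bMode m = 0 := by
  unfold bMode
  split_ifs
  · exact bcCreate_anticomm _ _
  · rw [add_comm, bcAnnih_create]; simp
  · rw [bcAnnih_create]; simp
  · exact bcAnnih_anticomm _ _

theorem cMode_anticomm (m n : ℤ) : cMode m * cMode n + cMode n * cMode m = 0 := by
  unfold cMode
  split_ifs
  · exact bcCreate_anticomm _ _
  · rw [add_comm, bcAnnih_create]; simp
  · rw [bcAnnih_create]; simp
  · exact bcAnnih_anticomm _ _

theorem bMode_cMode (m n : ℤ) :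
    bMode m * cMode n + cMode n * bMode m = if m = -n then 1 else 0 := by
  unfold bMode cMode
  split_ifs with h1 h2 h3 h3 h2 h3 h3
  · omega
  · rw [bcCreate_anticomm]
  · rw [add_comm, bcAnnih_create, if_pos]; congr 1; omega
  · rw [add_comm, bcAnnih_create, if_neg]; intro h; injection h; omega
  · rw [bcAnnih_create, if_pos]; congr 1; omega
  · rw [bcAnnih_create, if_neg]; intro h; injection h; omega
  · omega
  · exact bcAnnih_anticomm _ _

theorem bcAnnih_finite (v : BCFock) : {x | bcAnnih x v ≠ 0}.Finite := by
  induction v using CliffordAlgebra.left_induction with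
  | algebraMap r =>
    refine Set.finite_empty.subset fun x hx => hx ?_
    unfold bcAnnih
    rw [CliffordAlgebra.contractLeft_algebraMap]
  | add v w hv hw =>
    refine (hv.union hw).subset fun x hx => ?_
    by_contra hcon
    simp only [Set.mem_union, Set.mem_ofPred_eq, not_or, not_not] at hcon
    exact hx (by rw [map_add, hcon.1, hcon.2, add_zero])
  | ι_mul v a hv =>
    refine (hv.union a.support.finite_toSet).subset fun x hx => ?_
    by_contra hcon
    simp only [Set.mem_union, Set.mem_ofPred_eq, not_or, not_not, Finset.mem_coe,
      Finsupp.mem_support_iff] at hcon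
    refine hx ?_
    have h1 := hcon.1
    unfold bcAnnih at h1 ⊢
    rw [CliffordAlgebra.contractLeft_ι_mul, h1]
    simp [hcon.2]

theorem bMode_pos_finite (v : BCFock) : {k : ℤ | 1 ≤ k ∧ bMode k v ≠ 0}.Finite := by
  refine ((bcAnnih_finite v).image
    (Sum.elim (fun k : ℕ => -(k : ℤ)) (fun k : ℕ => (k : ℤ) + 1))).subset ?_
  rintro k ⟨h, hk⟩
  refine ⟨Sum.inr (k - 1).toNat, ?_, by simp; omega⟩
  have h2 : ¬ k ≤ 0 := by omega
  simpa [bMode, h2] using hk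

theorem cMode_nonneg_finite (v : BCFock) : {k : ℤ | 0 ≤ k ∧ cMode k v ≠ 0}.Finite := by
  refine ((bcAnnih_finite v).image
    (Sum.elim (fun k : ℕ => (k : ℤ)) (fun k : ℕ => (k : ℤ)))).subset ?_
  rintro k ⟨h, hk⟩
  refine ⟨Sum.inl k.toNat, ?_, by simp; omega⟩
  have h2 : ¬ k < 0 := by omega
  simpa [cMode, h2] using hk

/-- The normally ordered product `:c(-k) b(k):` (operators annihilating the vacuum stand on the
right, with the sign of the transposition). -/
def bcNormal (k : ℤ) : Module.End ℂ BCFock :=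
  if 1 ≤ k then cMode (-k) * bMode k else -(bMode k * cMode (-k))

theorem bcNormal_finite (v : BCFock) : (Function.support fun k => bcNormal k v).Finite := by
  refine ((bMode_pos_finite v).union ((cMode_nonneg_finite v).image Neg.neg)).subset ?_
  intro k hk
  rw [Function.mem_support] at hk
  unfold bcNormal at hk
  split_ifs at hk with h
  · exact Or.inl ⟨h, fun h0 => hk (by simp [h0])⟩
  · exact Or.inr ⟨-k, ⟨by omega, fun h0 => hk (by simp [h0])⟩, by simp⟩

/-- The zero mode `j^{bc}_0 = ∑_k :c(-k) b(k):` of the field `:c(z) b(z):`. -/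
def bcCurrentZero : Module.End ℂ BCFock := locFinSum bcNormal bcNormal_finite

/-- The subspace `F^l` of `bc`-charge `l`. -/
def bcCharge (l : ℤ) : Submodule ℂ BCFock := Module.End.eigenspace bcCurrentZero (l : ℂ)

theorem bcNormal_eq (k : ℤ) :
    bcNormal k = cMode (-k) * bMode k - if 1 ≤ k then 0 else 1 := by
  have h := bMode_cMode k (-k)
  rw [neg_neg, if_pos rfl] at h
  unfold bcNormal
  split_ifs
  · rw [sub_zero]
  · rw [← h]; abel

theorem ring_aux_b {R : Type} [Ring R] {b c B d p : R} (h1 : b * B + B * b = 0)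
    (h2 : B * c + c * B = d) (hp : p * B = B * p) :
    (c * b - p) * B = B * (c * b - p) - d * b := by
  have e1 : b * B = -(B * b) := eq_neg_of_add_eq_zero_left h1
  rw [sub_mul, mul_assoc, e1, hp, ← h2]
  noncomm_ring

theorem ring_aux_c {R : Type} [Ring R] {b c C d p : R} (h1 : c * C + C * c = 0)
    (h2 : b * C + C * b = d) (hp : p * C = C * p) :
    (c * b - p) * C = C * (c * b - p) + c * d := by
  have e1 : C * c = -(c * C) := eq_neg_of_add_eq_zero_right h1
  rw [sub_mul, mul_sub, hp, ← h2, ← mul_assoc C c b, e1]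
  noncomm_ring

theorem bcNormal_bMode (k n : ℤ) (v : BCFock) :
    bcNormal k (bMode n v) = bMode n (bcNormal k v) - if k = n then bMode n v else 0 := by
  have h := ring_aux_b (p := (if 1 ≤ k then 0 else 1 : Module.End ℂ BCFock))
    (bMode_anticomm k n) (bMode_cMode n (-k)) (by split_ifs <;> simp)
  rw [← bcNormal_eq] at h
  have h' := LinearMap.congr_fun h v
  rw [Module.End.mul_apply] at h'
  rw [h', LinearMap.sub_apply, Module.End.mul_apply]
  by_cases hk : k = n
  · subst hk; simp
  · have hk' : ¬ n = - -k := by omega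
    simp [hk, Ne.symm hk]

theorem bcNormal_cMode (k n : ℤ) (v : BCFock) :
    bcNormal k (cMode n v) = cMode n (bcNormal k v) + if k = -n then cMode n v else 0 := by
  have h := ring_aux_c (p := (if 1 ≤ k then 0 else 1 : Module.End ℂ BCFock))
    (cMode_anticomm (-k) n) (bMode_cMode k n) (by split_ifs <;> simp)
  rw [← bcNormal_eq] at h
  have h' := LinearMap.congr_fun h v
  rw [Module.End.mul_apply] at h'
  rw [h', LinearMap.add_apply, Module.End.mul_apply]
  by_cases hk : k = -n
  · subst hk; simp
  · simp [hk]

theorem finsum_single {V : Type} [AddCommGroup V] (n : ℤ) (v : V) :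
    (Function.support fun k : ℤ => if k = n then v else 0).Finite ∧
      ∑ᶠ k : ℤ, (if k = n then v else 0) = v := by
  refine ⟨(Set.finite_singleton n).subset fun k hk => ?_, ?_⟩
  · by_contra hcon
    exact hk (if_neg hcon)
  · rw [finsum_eq_single _ n (fun k hk => if_neg hk), if_pos rfl]

theorem bMode_mem {l : ℤ} (n : ℤ) {v : BCFock} (hv : v ∈ bcCharge l) :
    bMode n v ∈ bcCharge (l - 1) := by
  unfold bcCharge at hv ⊢
  rw [Module.End.mem_eigenspace_iff, bcCurrentZero, locFinSum_apply] at hv ⊢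
  simp only [bcNormal_bMode]
  have hfin : (Function.support fun k => bMode n (bcNormal k v)).Finite :=
    (bcNormal_finite v).subset fun k hk h0 => hk (by simp only [h0, map_zero])
  have h1 : bMode n (∑ᶠ k, bcNormal k v) = ∑ᶠ k, bMode n (bcNormal k v) :=
    (bMode n).toAddMonoidHom.map_finsum (bcNormal_finite v)
  rw [finsum_sub_distrib hfin (finsum_single n _).1, (finsum_single n _).2,
    ← h1, hv, map_smul]
  push_cast
  rw [sub_smul, one_smul]

theorem cMode_mem {l : ℤ} (n : ℤ) {v : BCFock} (hv : v ∈ bcCharge l) :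
    cMode n v ∈ bcCharge (l + 1) := by
  unfold bcCharge at hv ⊢
  rw [Module.End.mem_eigenspace_iff, bcCurrentZero, locFinSum_apply] at hv ⊢
  simp only [bcNormal_cMode]
  have hfin : (Function.support fun k => cMode n (bcNormal k v)).Finite :=
    (bcNormal_finite v).subset fun k hk h0 => hk (by simp only [h0, map_zero])
  have h1 : cMode n (∑ᶠ k, bcNormal k v) = ∑ᶠ k, cMode n (bcNormal k v) :=
    (cMode n).toAddMonoidHom.map_finsum (bcNormal_finite v)
  rw [finsum_add_distrib hfin (finsum_single (-n) _).1, (finsum_single (-n) _).2,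
    ← h1, hv, map_smul]
  push_cast
  rw [add_smul, one_smul]

/-- `b(n) : F^l → F^(l-1)`. -/
def bComp (l n : ℤ) : bcCharge l →ₗ[ℂ] bcCharge (l - 1) :=
  (bMode n).restrict fun _ hv => bMode_mem n hv

/-- `c(n) : F^l → F^(l+1)`. -/
def cComp (l n : ℤ) : bcCharge l →ₗ[ℂ] bcCharge (l + 1) :=
  (cMode n).restrict fun _ hv => cMode_mem n hv

/-- The kernel `\bar F^l` of `c(0) : F^l → F^(l+1)`. -/
def barF (l : ℤ) : Submodule ℂ (bcCharge l) := LinearMap.ker (cComp l 0)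

theorem bcVac_mem : bcVac ∈ bcCharge 0 := by
  unfold bcCharge
  rw [Module.End.mem_eigenspace_iff, bcCurrentZero, locFinSum_apply]
  have h : ∀ x, bcAnnih x bcVac = 0 := fun x => by
    unfold bcAnnih bcVac
    rw [CliffordAlgebra.contractLeft_one]
  have h0 : ∀ k, bcNormal k bcVac = 0 := fun k => by
    unfold bcNormal
    split_ifs with hk
    · have h2 : ¬ k ≤ 0 := by omega
      rw [Module.End.mul_apply, bMode, if_neg h2, h, map_zero]
    · have h2 : ¬ -k < 0 := by omega
      rw [LinearMap.neg_apply, Module.End.mul_apply, cMode, if_neg h2, h, map_zero, neg_zero]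
  simp only [h0, finsum_zero, Int.cast_zero, zero_smul]

/-! ### Heisenberg Fock spaces and vertex operators

`H_α` has as underlying space the polynomials in the creation operators: the variable `n` is
`j(-n-1)`, `n ≥ 0`, and the vacuum vector `|α⟩` is `1`.  The number `α` enters through the action of
`j(0)` and through the powers of `z` in the vertex operators. -/

/-- The Fock space `H_α` of the free bosonic field `j(z) = ∑ j(n) z^(-n-1)`. -/
abbrev HeisFock (_α : ℂ) : Type := MvPolynomial ℕ ℂ

/-- The vacuum vector `|α⟩` of `H_α`. -/
def heisVac (α : ℂ) : HeisFock α := 1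

/-- The mode `j(n)` acting on `H_α`; `[j(m), j(n)] = m δ_{m,-n}`. -/
def heisMode (α : ℂ) (n : ℤ) : Module.End ℂ (HeisFock α) :=
  if n < 0 then LinearMap.mulLeft ℂ (MvPolynomial.X (-n - 1).toNat)
  else if n = 0 then α • LinearMap.id
  else (n : ℂ) • (MvPolynomial.pderiv (n - 1).toNat).toLinearMap

/-- The operator `exp(η q) : H_α → H_{α+η}`: it sends `|α⟩` to `|α+η⟩` and commutes with
`j(n)`, `n ≠ 0`. -/
def expQ (η α : ℂ) : HeisFock α →ₗ[ℂ] HeisFock (α + η) := LinearMap.id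

/-- The exponential `∑_k f^k / k!` of a power series `f` with zero constant coefficient over a
(possibly noncommutative) `ℂ`-algebra. -/
def expSeries {R : Type} [Ring R] [Algebra ℂ R] (f : PowerSeries R) : PowerSeries R :=
  PowerSeries.mk fun n =>
    ∑ k ∈ Finset.range (n + 1), ((k.factorial : ℂ)⁻¹) • PowerSeries.coeff n (f ^ k)

/-- `η ∑_{n > 0} j(-n) z^n / n` as a power series in `z`. -/
def creationSeries (η α : ℂ) : PowerSeries (Module.End ℂ (HeisFock α)) :=
  PowerSeries.mk fun n => if n = 0 then 0 else (η / n) • heisMode α (-n)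

/-- `η ∑_{n < 0} j(-n) z^n / n = - η ∑_{n > 0} j(n) z^(-n) / n` as a power series in `z⁻¹`. -/
def annihSeries (η α : ℂ) : PowerSeries (Module.End ℂ (HeisFock α)) :=
  PowerSeries.mk fun n => if n = 0 then 0 else (-(η / n)) • heisMode α n

/-- The coefficient of `z^n` in `exp(η ∑_{n > 0} j(-n) z^n / n)` (zero for `n < 0`). -/
def expCreation (η α : ℂ) (n : ℤ) : Module.End ℂ (HeisFock α) :=
  if n < 0 then 0 else PowerSeries.coeff n.toNat (expSeries (creationSeries η α))

/-- The coefficient of `z^(-n)` in `exp(η ∑_{n < 0} j(-n) z^n / n)`. -/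
def expAnnih (η α : ℂ) (n : ℕ) : Module.End ℂ (HeisFock α) :=
  PowerSeries.coeff n (expSeries (annihSeries η α))

/-- `v` has degree at most `d`, where `j(-n)` has degree `n`. -/
def HeisDegLE (d : ℕ) (v : MvPolynomial ℕ ℂ) : Prop :=
  ∀ u ∈ v.support, Finsupp.weight (fun n : ℕ => n + 1) u ≤ d

theorem exists_heisDegLE (v : MvPolynomial ℕ ℂ) : ∃ d, HeisDegLE d v :=
  ⟨v.support.sup fun u => Finsupp.weight (fun n : ℕ => n + 1) u,
    fun _ hu => Finset.le_sup (f := fun u => Finsupp.weight (fun n : ℕ => n + 1) u) hu⟩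

theorem HeisDegLE.smul {d : ℕ} {v : MvPolynomial ℕ ℂ} (h : HeisDegLE d v) (a : ℂ) :
    HeisDegLE d (a • v) := fun u hu => h u (MvPolynomial.support_smul hu)

theorem HeisDegLE.pderiv_support {d : ℕ} {v : MvPolynomial ℕ ℂ} (h : HeisDegLE d v) (n : ℕ)
    (u : ℕ →₀ ℕ) (hu : u ∈ (MvPolynomial.pderiv n v).support) :
    Finsupp.weight (fun n : ℕ => n + 1) u + (n + 1) ≤ d := by
  rw [MvPolynomial.mem_support_iff, MvPolynomial.coeff_pderiv] at hu
  have := h _ (MvPolynomial.mem_support_iff.mpr (left_ne_zero_of_mul hu))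
  simpa [map_add, Finsupp.weight_single] using this

theorem heisMode_degLE {d : ℕ} {v : MvPolynomial ℕ ℂ} (h : HeisDegLE d v) (α : ℂ) (n : ℕ)
    (hn : n ≠ 0) :
    (d < n → heisMode α n v = 0) ∧ HeisDegLE (d - n) (heisMode α n v) := by
  have e : heisMode α n v = (n : ℂ) • MvPolynomial.pderiv (n - 1) v := by
    have h1 : ¬ (n : ℤ) < 0 := by omega
    have h2 : ¬ (n : ℤ) = 0 := by omega
    have h3 : ((n : ℤ) - 1).toNat = n - 1 := by omega
    rw [heisMode, if_neg h1, if_neg h2, h3]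
    simp
  rw [e]
  refine ⟨fun hd => ?_, HeisDegLE.smul (fun u hu => ?_) _⟩
  · have : (MvPolynomial.pderiv (n - 1) v).support = ∅ := by
      refine Finset.eq_empty_of_forall_notMem fun u hu => ?_
      have := h.pderiv_support _ u hu
      omega
    rw [MvPolynomial.support_eq_empty.mp this, smul_zero]
  · have := h.pderiv_support _ u hu
    omega

theorem annihSeries_pow_apply (η α : ℂ) (k : ℕ) : ∀ (d m : ℕ) (v : HeisFock α), HeisDegLE d v →
    d < m → PowerSeries.coeff m (annihSeries η α ^ k) v = 0 := by
  induction k with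
  | zero =>
    intro d m v _ hm
    rw [pow_zero, PowerSeries.coeff_one, if_neg (by omega), LinearMap.zero_apply]
  | succ k ih =>
    intro d m v hv hm
    rw [pow_succ, PowerSeries.coeff_mul, LinearMap.sum_apply]
    refine Finset.sum_eq_zero fun p hp => ?_
    have hp' : p.1 + p.2 = m := by simpa using hp
    rw [Module.End.mul_apply, annihSeries, PowerSeries.coeff_mk]
    split_ifs with h0
    · rw [LinearMap.zero_apply, map_zero]
    · obtain ⟨h1, h2⟩ := heisMode_degLE hv α p.2 h0
      rw [LinearMap.smul_apply, map_smul]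
      by_cases hd : d < p.2
      · rw [h1 hd, map_zero, smul_zero]
      · have := ih (d - p.2) p.1 _ h2 (by omega)
        rw [annihSeries] at this
        rw [this, smul_zero]

theorem expAnnih_eventually (η α : ℂ) (v : HeisFock α) :
    ∃ d : ℕ, ∀ m, d < m → expAnnih η α m v = 0 := by
  obtain ⟨d, hd⟩ := exists_heisDegLE v
  refine ⟨d, fun m hm => ?_⟩
  rw [expAnnih, expSeries, PowerSeries.coeff_mk, LinearMap.sum_apply]
  refine Finset.sum_eq_zero fun k _ => ?_
  rw [LinearMap.smul_apply, annihSeries_pow_apply η α k d m v hd hm, smul_zero]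

theorem vertex_finite (η α : ℂ) (n : ℤ) (v : HeisFock α) :
    (Function.support fun m : ℕ =>
      (expQ η α ∘ₗ (expCreation η α (m - n) * expAnnih η α m)) v).Finite := by
  obtain ⟨d, hd⟩ := expAnnih_eventually η α v
  refine (Set.finite_Iic d).subset fun m hm => ?_
  by_contra hcon
  refine hm ?_
  change expQ η α (expCreation η α (m - n) (expAnnih η α m v)) = 0
  rw [hd m (not_le.mp hcon), map_zero, map_zero]

/-- The component `X_η(n) : H_α → H_{α+η}` of the vertex operator
`X_η(z) = exp(η q) z^(ηα) exp(η ∑_{n>0} j(-n) z^n/n) exp(η ∑_{n<0} j(-n) z^n/n)`,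
i.e. the coefficient of `z^(ηα - n)`. -/
def vertexMode (η α : ℂ) (n : ℤ) : HeisFock α →ₗ[ℂ] HeisFock (α + η) :=
  locFinSum (fun m : ℕ => expQ η α ∘ₗ (expCreation η α (m - n) * expAnnih η α m))
    (vertex_finite η α n)

theorem vertexMode_eventually (η α : ℂ) (v : HeisFock α) :
    ∃ d : ℤ, ∀ n, d < n → vertexMode η α n v = 0 := by
  obtain ⟨d, hd⟩ := expAnnih_eventually η α v
  refine ⟨d, fun n hn => ?_⟩
  rw [vertexMode, locFinSum_apply]
  refine finsum_eq_zero_of_forall_eq_zero fun m => ?_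
  change expQ η α (expCreation η α (m - n) (expAnnih η α m v)) = 0
  by_cases hm : d < m
  · rw [hd m hm, map_zero, map_zero]
  · rw [expCreation, if_pos (by omega), LinearMap.zero_apply, map_zero]

/-! ### The space `N(s)` and the action of `β(n)`, `γ(n)` on it -/

/-- The summand `F^l ⊗ H_{i(s+l)}` of `N(s)`. -/
abbrev NComp (s : ℂ) (l : ℤ) : Type := bcCharge l ⊗[ℂ] HeisFock (Complex.I * (s + l))

/-- The space `N(s) = ⨁_l F^l ⊗ H_{i(s+l)}`. -/
abbrev N (s : ℂ) : Type := DirectSum ℤ (NComp s)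

instance instAddCommGroupN (s : ℂ) : AddCommGroup (N s) :=
  @DirectSum.instAddCommGroup ℤ (NComp s) fun _ => TensorProduct.addCommGroup

/-- The vector `|bc⟩ ⊗ |is⟩` of `F^0 ⊗ H_{is}`. -/
def NVac (s : ℂ) : N s :=
  DirectSum.lof ℂ ℤ (NComp s) 0 (⟨bcVac, bcVac_mem⟩ ⊗ₜ heisVac (Complex.I * (s + (0 : ℤ))))

theorem weight_sub (s : ℂ) (l : ℤ) :
    Complex.I * (s + l) + -Complex.I = Complex.I * (s + (l - 1 : ℤ)) := by
  push_cast; ring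

theorem weight_add (s : ℂ) (l : ℤ) :
    Complex.I * (s + l) + Complex.I = Complex.I * (s + (l + 1 : ℤ)) := by
  push_cast; ring

theorem weight_cZero (s : ℂ) (l : ℤ) :
    Complex.I * (s + l) = Complex.I * ((s - 1) + (l + 1 : ℤ)) := by
  push_cast; ring

/-- The product of the `z^(-k-1)`-term `-k b(k)` of `∂b(z)` and of `X_{-i}(m)`, the coefficient of
`z^(-i·i(s+l) - m)` in `X_{-i}(z)` on `H_{i(s+l)}`.  It lands in `H_{i(s+l)-i} = H_{i(s+l-1)}`,
see `weight_sub`. -/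
def betaTerm (s : ℂ) (l k m : ℤ) : NComp s l →ₗ[ℂ] NComp s (l - 1) :=
  TensorProduct.map ((-k : ℂ) • bComp l k) (vertexMode (-Complex.I) (Complex.I * (s + l)) m)

/-- The product of the `z^(-k-1)`-term `c(k)` of `c(z)` and of `X_i(m)`, the coefficient of
`z^(i·i(s+l) - m)` in `X_i(z)` on `H_{i(s+l)}`.  It lands in `H_{i(s+l)+i} = H_{i(s+l+1)}`,
see `weight_add`. -/
def gammaTerm (s : ℂ) (l k m : ℤ) : NComp s l →ₗ[ℂ] NComp s (l + 1) :=
  TensorProduct.map (cComp l k) (vertexMode Complex.I (Complex.I * (s + l)) m)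

/-- The power of `z` carried by `betaTerm s l k (n - k - 1 + l)` is `z^(-n+s)`. -/
theorem beta_exponent (s : ℂ) (l k n : ℤ) :
    (-k - 1 : ℂ) + (-Complex.I * (Complex.I * (s + l)) - (n - k - 1 + l : ℤ)) = -n + s := by
  push_cast
  linear_combination (-(s + l)) * Complex.I_mul_I

/-- The power of `z` carried by `gammaTerm s l k (n - k - l)` is `z^(-n-s-1)`. -/
theorem gamma_exponent (s : ℂ) (l k n : ℤ) :
    (-k - 1 : ℂ) + (Complex.I * (Complex.I * (s + l)) - (n - k - l : ℤ)) = -n - s - 1 := by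
  push_cast
  linear_combination (s + l) * Complex.I_mul_I

theorem tensor_finite {V W V' W' : Type} [AddCommGroup V] [Module ℂ V] [AddCommGroup W] [Module ℂ W]
    [AddCommGroup V'] [Module ℂ V'] [AddCommGroup W'] [Module ℂ W']
    (f : ℤ → V →ₗ[ℂ] V') (g : ℤ → W →ₗ[ℂ] W')
    (hf : ∀ v, ∃ d : ℤ, ∀ k, d < k → f k v = 0) (hg : ∀ w, ∃ d : ℤ, ∀ k, d < k → g k w = 0) (a : ℤ)
    (x : V ⊗[ℂ] W) :
    (Function.support fun k => TensorProduct.map (f k) (g (a - k)) x).Finite := by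
  induction x using TensorProduct.induction_on with
  | zero => simp
  | tmul v w =>
    obtain ⟨d, hd⟩ := hf v
    obtain ⟨e, he⟩ := hg w
    refine (Set.finite_Icc (a - e) d).subset fun k hk => ?_
    by_contra hcon
    refine hk ?_
    change f k v ⊗ₜ[ℂ] g (a - k) w = 0
    rcases not_and_or.mp hcon with h | h
    · rw [he _ (by omega), TensorProduct.tmul_zero]
    · rw [hd _ (by omega), TensorProduct.zero_tmul]
  | add x y hx hy =>
    refine (hx.union hy).subset fun k hk => ?_
    by_contra hcon
    simp only [Set.mem_union, Function.mem_support, not_or, not_not] at hcon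
    exact hk (by simp only [map_add, hcon.1, hcon.2, add_zero])

theorem bMode_eventually (v : BCFock) : ∃ d : ℤ, ∀ k, d < k → bMode k v = 0 := by
  obtain ⟨d, hd⟩ := (bMode_pos_finite v).bddAbove
  refine ⟨max d 0, fun k hk => ?_⟩
  by_contra hcon
  have := hd ⟨by omega, hcon⟩
  omega

theorem cMode_eventually (v : BCFock) : ∃ d : ℤ, ∀ k, d < k → cMode k v = 0 := by
  obtain ⟨d, hd⟩ := (cMode_nonneg_finite v).bddAbove
  refine ⟨max d 0, fun k hk => ?_⟩
  by_contra hcon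
  have := hd ⟨by omega, hcon⟩
  omega

theorem betaTerm_finite (s : ℂ) (l n : ℤ) (x : NComp s l) :
    (Function.support fun k : ℤ => betaTerm s l k (n - k - 1 + l) x).Finite := by
  have h := tensor_finite (fun k : ℤ => (-k : ℂ) • bComp l k)
    (vertexMode (-Complex.I) (Complex.I * (s + l)))
    (fun v => by
      obtain ⟨d, hd⟩ := bMode_eventually v
      refine ⟨d, fun k hk => ?_⟩
      have : bComp l k v = 0 := Subtype.ext (hd k hk)
      rw [LinearMap.smul_apply, this, smul_zero])
    (vertexMode_eventually _ _) (n - 1 + l) x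
  refine h.subset fun k hk => ?_
  rw [Function.mem_support] at hk ⊢
  rwa [betaTerm, show n - k - 1 + l = n - 1 + l - k by ring] at hk

theorem gammaTerm_finite (s : ℂ) (l n : ℤ) (x : NComp s l) :
    (Function.support fun k : ℤ => gammaTerm s l k (n - k - l) x).Finite := by
  have h := tensor_finite (fun k : ℤ => cComp l k)
    (vertexMode Complex.I (Complex.I * (s + l)))
    (fun v => by
      obtain ⟨d, hd⟩ := cMode_eventually v
      exact ⟨d, fun k hk => Subtype.ext (hd k hk)⟩)
    (vertexMode_eventually _ _) (n - l) x
  refine h.subset fun k hk => ?_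
  rw [Function.mem_support] at hk ⊢
  rwa [gammaTerm, show n - k - l = n - l - k by ring] at hk

/-- The mode `β(n)` on `N(s)`: the coefficient of `z^(-n+s)` in `∂b(z) X_{-i}(z)`. -/
def betaN (s : ℂ) (n : ℤ) : Module.End ℂ (N s) :=
  DirectSum.toModule ℂ ℤ (N s) fun l =>
    DirectSum.lof ℂ ℤ (NComp s) (l - 1) ∘ₗ
      locFinSum (fun k : ℤ => betaTerm s l k (n - k - 1 + l)) (betaTerm_finite s l n)

/-- The mode `γ(n)` on `N(s)`: the coefficient of `z^(-n-s-1)` in `c(z) X_i(z)`. -/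
def gammaN (s : ℂ) (n : ℤ) : Module.End ℂ (N s) :=
  DirectSum.toModule ℂ ℤ (N s) fun l =>
    DirectSum.lof ℂ ℤ (NComp s) (l + 1) ∘ₗ
      locFinSum (fun k : ℤ => gammaTerm s l k (n - k - l)) (gammaTerm_finite s l n)

/-- The operator `c(0) : N(s) → N(s-1)`, acting on the first tensor factors:
`F^l ⊗ H_{i(s+l)} → F^(l+1) ⊗ H_{i((s-1)+(l+1))}`, see `weight_cZero`. -/
def cZero (s : ℂ) : N s →ₗ[ℂ] N (s - 1) :=
  DirectSum.toModule ℂ ℤ (N (s - 1)) fun l =>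
    DirectSum.lof ℂ ℤ (NComp (s - 1)) (l + 1) ∘ₗ
      TensorProduct.map (cComp l 0) (LinearMap.id : HeisFock (Complex.I * (s + l)) →ₗ[ℂ]
        HeisFock (Complex.I * ((s - 1) + (l + 1 : ℤ))))

/-- `ε : M_s → N(s)` intertwines the actions of all `β(n)`, `γ(n)` and sends the vacuum vector to
`|bc⟩ ⊗ |is⟩`. -/
structure IsFMSHom (s : ℂ) (ε : BGFock →ₗ[ℂ] N s) : Prop where
  map_beta : ∀ (n : ℤ) (v : BGFock), ε (betaMode n v) = betaN s n (ε v)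
  map_gamma : ∀ (n : ℤ) (v : BGFock), ε (gammaMode n v) = gammaN s n (ε v)
  map_vac : ε bgVac = NVac s

end FMS

end

noncomputable section

namespace FMS

/-! ### Exponentials of power series -/

/-! All the spaces H_α share one polynomial ring, and once z^(ηα) is split off, X_η(z) no longer
depends on α. Two rules determine it: X_η(z) 1 = h_η(z), the generating series of the polynomials
`schur`, and X_η(z) x_n = (x_n - η z^(-n-1)) X_η(z). By the second rule an identity between products
of two such fields need only be checked on vectors v ⊗ 1 (`eq_zero_of_covariant`). N(s) is embedded
in the families of vectors of the fixed space F ⊗ ℂ[x], where these identities apply.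

Commutation relations. For η² = -1, opposite exponents contribute (1 - w/z) h_η(z) h_(-η)(w) and
equal exponents (1 - w/z)⁻¹ h_η(z) h_η(w) (`vertexOp_schur_neg`, `vertexOp_schur_self`). In the
equal case the two orderings combine into coefficients that depend on the total degree only, and the
anticommuting fermions cancel them (`modeSum_comm_self`). For γ against β, the simple zero at z = w
meets the derivative of the delta function coming from c and ∂b, and leaves the delta function
itself (`opC_opB`).

The map ε. Creation modes commute, so polynomials in them act on N(s); ε applies a polynomial to the
vacuum. Its kernel is stable under all partial derivatives, which are annihilation modes up to sign,
and does not contain 1, so it is zero.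

The image. It lies in ker c(0) because c(0) anticommutes with every c(n) and every -n b(n).
Conversely, a mode of the current :γβ: produces x_a on the vacuum, and covariance makes the whole
image stable under every x_a (`fullX_mem`). The fermion modes c(k) and k b(k) can then be split off
from the vertex operators by a triangular system (`mode_tmul_one_mem`). The creation operators other
than b(0) generate ker c(0) in F from the vacuum (`mem_of_cMode_zero_eq_zero`), and flatness passes
from F to F ⊗ H. The zero mode of the current acts on the summand of index l as -l, which matches
the charges. -/

theorem coeff_pow_eq_zero {R : Type} [Ring R] {f : PowerSeries R} (hf : PowerSeries.coeff 0 f = 0)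
    (k : ℕ) : ∀ n, n < k → PowerSeries.coeff n (f ^ k) = 0 := by
  induction k with
  | zero => intro n hn; omega
  | succ k ih =>
    intro n hn
    rw [pow_succ, PowerSeries.coeff_mul]
    refine Finset.sum_eq_zero fun p hp => ?_
    have hp' : p.1 + p.2 = n := by simpa using hp
    by_cases h : p.2 = 0
    · rw [h, hf, mul_zero]
    · rw [ih p.1 (by omega), zero_mul]

/-- Powers f^k with k > n have no term of degree n, so the cut-off may be raised freely. Comparing
coefficients of different degrees needs a common one. -/
theorem coeff_expSeries {R : Type} [Ring R] [Algebra ℂ R] {f : PowerSeries R}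
    (hf : PowerSeries.coeff 0 f = 0) {n N : ℕ} (h : n < N) :
    PowerSeries.coeff n (expSeries f) =
      ∑ k ∈ Finset.range N, ((k.factorial : ℂ)⁻¹) • PowerSeries.coeff n (f ^ k) := by
  rw [expSeries, PowerSeries.coeff_mk]
  refine Finset.sum_subset (fun k hk => ?_) fun k _ hk => ?_
  · simp only [Finset.mem_range] at hk ⊢; omega
  · simp only [Finset.mem_range, not_lt] at hk
    rw [coeff_pow_eq_zero hf k n (by omega), smul_zero]

theorem expSeries_map {R S : Type} [Ring R] [Algebra ℂ R] [Ring S] [Algebra ℂ S] (φ : R →ₐ[ℂ] S)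
    (f : PowerSeries R) :
    expSeries (PowerSeries.map (φ : R →+* S) f) = PowerSeries.map (φ : R →+* S) (expSeries f) := by
  ext n
  simp only [expSeries, PowerSeries.coeff_mk, PowerSeries.coeff_map, ← map_pow, map_sum,
    RingHom.coe_coe, map_smul]

theorem expSeries_derivative {R : Type} [CommRing R] [Algebra ℂ R] {f : PowerSeries R}
    (hf : PowerSeries.coeff 0 f = 0) :
    PowerSeries.derivative R (expSeries f) = PowerSeries.derivative R f * expSeries f := by
  ext n
  rw [PowerSeries.coeff_derivative, coeff_expSeries hf (Nat.lt_succ_self (n + 1)),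
    PowerSeries.coeff_mul, Finset.sum_mul, Finset.sum_range_succ']
  have h1 : ∀ p ∈ Finset.HasAntidiagonal.antidiagonal n,
      PowerSeries.coeff p.1 (PowerSeries.derivative R f) * PowerSeries.coeff p.2 (expSeries f) =
      ∑ k ∈ Finset.range (n + 1), ((k.factorial : ℂ)⁻¹) •
        (PowerSeries.coeff p.1 (PowerSeries.derivative R f) * PowerSeries.coeff p.2 (f ^ k)) := by
    intro p hp
    have hp' : p.1 + p.2 = n := by simpa using hp
    rw [coeff_expSeries hf (show p.2 < n + 1 by omega), Finset.mul_sum]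
    exact Finset.sum_congr rfl fun k _ => mul_smul_comm _ _ _
  rw [Finset.sum_congr rfl h1, Finset.sum_comm]
  -- The term k = 0 has derivative zero; the term k + 1 on the left then matches the term k on the
  -- right.
  have h0 : ((Nat.factorial 0 : ℂ)⁻¹) • PowerSeries.coeff (n + 1) (f ^ 0) * ((n : R) + 1) = 0 := by
    rw [pow_zero, PowerSeries.coeff_one, if_neg (by omega), smul_zero, zero_mul]
  rw [h0, add_zero]
  refine Finset.sum_congr rfl fun k _ => ?_
  rw [← Finset.smul_sum, ← PowerSeries.coeff_mul, smul_mul_assoc, ← PowerSeries.coeff_derivative,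
    PowerSeries.derivative_pow, Nat.add_sub_cancel, mul_assoc]
  have e : ((k + 1 : ℕ) : PowerSeries R) = algebraMap ℂ (PowerSeries R) ((k + 1 : ℕ) : ℂ) := by
    rw [map_natCast]
  rw [e, ← Algebra.smul_def, ← algebraMap_smul R, PowerSeries.coeff_smul, smul_eq_mul,
    ← Algebra.smul_def, smul_smul, mul_comm (PowerSeries.derivative R f)]
  congr 1
  have := Nat.cast_ne_zero (R := ℂ).mpr (Nat.succ_ne_zero k)
  rw [Nat.factorial_succ, Nat.cast_mul, mul_inv, mul_comm, ← mul_assoc, mul_inv_cancel₀ this,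
    one_mul]

/-! ### The coefficients of the creation part of a vertex operator -/

/-- `η ∑_{n > 0} x_{n-1} z^n / n`. -/
def powerSumSeries (η : ℂ) : PowerSeries (MvPolynomial ℕ ℂ) :=
  PowerSeries.mk fun n => if n = 0 then 0 else (η / n) • MvPolynomial.X (n - 1)

theorem powerSumSeries_coeff_zero (η : ℂ) : PowerSeries.coeff 0 (powerSumSeries η) = 0 := by
  simp [powerSumSeries]

theorem coeff_derivative_powerSumSeries (η : ℂ) (n : ℕ) :
    PowerSeries.coeff n (PowerSeries.derivative _ (powerSumSeries η)) =
      η • MvPolynomial.X n := by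
  rw [PowerSeries.coeff_derivative, powerSumSeries, PowerSeries.coeff_mk, if_neg (by omega)]
  have : ((n : MvPolynomial ℕ ℂ) + 1) = algebraMap ℂ _ ((n + 1 : ℕ) : ℂ) := by simp
  rw [this, mul_comm, ← Algebra.smul_def, smul_smul, Nat.add_sub_cancel,
    mul_div_cancel₀ _ (Nat.cast_ne_zero.mpr (Nat.succ_ne_zero n))]

/-- The coefficient of `z^n` in `exp(η ∑_{n > 0} x_{n-1} z^n / n)`, zero for `n < 0`. -/
def schur (η : ℂ) (n : ℤ) : MvPolynomial ℕ ℂ :=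
  if n < 0 then 0 else PowerSeries.coeff n.toNat (expSeries (powerSumSeries η))

theorem schur_neg (η : ℂ) {n : ℤ} (h : n < 0) : schur η n = 0 := if_pos h

theorem schur_natCast (η : ℂ) (n : ℕ) :
    schur η n = PowerSeries.coeff n (expSeries (powerSumSeries η)) := by
  rw [schur, if_neg (by omega), Int.toNat_natCast]

theorem schur_zero (η : ℂ) : schur η 0 = 1 := by
  have := schur_natCast η 0
  rw [Nat.cast_zero] at this
  rw [this]
  simp [expSeries]

/-- Coefficient of z^(a-1) in h' = p' h with p' = η ∑ x_n z^n. This recursion drives the inductions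
on vertex operators below. -/
theorem schur_rec (η : ℂ) (a : ℕ) :
    (a : ℂ) • schur η a =
      η • ∑ n ∈ Finset.range a, MvPolynomial.X n * schur η ((a : ℤ) - 1 - n) := by
  cases a with
  | zero => simp
  | succ a =>
    have h := congrArg (PowerSeries.coeff a) (expSeries_derivative (powerSumSeries_coeff_zero η))
    rw [PowerSeries.coeff_derivative, PowerSeries.coeff_mul,
      Finset.Nat.sum_antidiagonal_eq_sum_range_succ (fun i j =>
      PowerSeries.coeff i (PowerSeries.derivative _ (powerSumSeries η)) *
        PowerSeries.coeff j (expSeries (powerSumSeries η))), ← schur_natCast] at h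
    have e : ((a : MvPolynomial ℕ ℂ) + 1) = algebraMap ℂ _ ((a + 1 : ℕ) : ℂ) := by simp
    rw [e, mul_comm, ← Algebra.smul_def] at h
    rw [h, Finset.smul_sum]
    refine Finset.sum_congr rfl fun n hn => ?_
    simp only [Finset.mem_range] at hn
    rw [coeff_derivative_powerSumSeries, ← schur_natCast, smul_mul_assoc]
    congr 3
    omega

/-- By the differential equation of the exponential the product has derivative zero, and its
constant term is 1. -/
theorem expSeries_powerSum_mul (η : ℂ) :
    expSeries (powerSumSeries η) * expSeries (powerSumSeries (-η)) = 1 := by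
  have hneg : powerSumSeries (-η) = -powerSumSeries η := by
    ext1 n
    simp only [powerSumSeries, PowerSeries.coeff_mk, map_neg]
    split_ifs
    · rw [neg_zero]
    · rw [neg_div, neg_smul]
  refine PowerSeries.derivative.ext ?_ ?_
  · rw [Derivation.leibniz, expSeries_derivative (powerSumSeries_coeff_zero _),
      expSeries_derivative (powerSumSeries_coeff_zero _), hneg, map_neg,
      PowerSeries.derivative_one]
    simp only [smul_eq_mul]
    ring
  · rw [map_mul, map_one]
    simp [expSeries]

/-- `∑_i h_i(η) h_{n-i}(-η) = δ_{n,0}`. -/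
theorem sum_schur_mul_schur_neg (η : ℂ) (n : ℕ) :
    ∑ i ∈ Finset.range (n + 1), schur η i * schur (-η) ((n : ℤ) - i) = if n = 0 then 1 else 0 := by
  have h := congrArg (PowerSeries.coeff n) (expSeries_powerSum_mul η)
  rw [PowerSeries.coeff_mul, Finset.Nat.sum_antidiagonal_eq_sum_range_succ (fun i j =>
    PowerSeries.coeff i (expSeries (powerSumSeries η)) *
      PowerSeries.coeff j (expSeries (powerSumSeries (-η)))), PowerSeries.coeff_one] at h
  rw [← h]
  refine Finset.sum_congr rfl fun i hi => ?_
  simp only [Finset.mem_range] at hi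
  rw [← schur_natCast, ← schur_natCast, Nat.cast_sub (by omega)]

/-- `∑_i i h_i(η) h_{n-i}(-η) = η x_{n-1}`. -/
theorem sum_mul_schur_mul_schur_neg (η : ℂ) (n : ℕ) :
    ∑ i ∈ Finset.range (n + 2), (i : ℂ) • (schur η i * schur (-η) ((n : ℤ) + 1 - i)) =
      η • MvPolynomial.X n := by
  have h : PowerSeries.derivative _ (expSeries (powerSumSeries η)) *
      expSeries (powerSumSeries (-η)) = PowerSeries.derivative _ (powerSumSeries η) := by
    rw [expSeries_derivative (powerSumSeries_coeff_zero _), mul_assoc, expSeries_powerSum_mul,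
      mul_one]
  have h := congrArg (PowerSeries.coeff n) h
  rw [PowerSeries.coeff_mul, Finset.Nat.sum_antidiagonal_eq_sum_range_succ (fun i j =>
    PowerSeries.coeff i (PowerSeries.derivative _ (expSeries (powerSumSeries η))) *
      PowerSeries.coeff j (expSeries (powerSumSeries (-η)))),
    coeff_derivative_powerSumSeries] at h
  rw [← h, Finset.sum_range_succ', Nat.cast_zero, zero_smul, add_zero]
  refine Finset.sum_congr rfl fun i hi => ?_
  simp only [Finset.mem_range] at hi
  have e : ((i : MvPolynomial ℕ ℂ) + 1) = algebraMap ℂ _ ((i + 1 : ℕ) : ℂ) := by simp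
  rw [PowerSeries.coeff_derivative, ← schur_natCast, ← schur_natCast, e,
    mul_comm (schur η _) (algebraMap _ _ _), ← Algebra.smul_def, smul_mul_assoc]
  congr 3
  omega

/-- Creation modes are multiplication operators, so the exponential can be computed in the
commutative polynomial ring and carried over by the regular representation. -/
theorem expCreation_apply (η α : ℂ) (n : ℤ) (v : MvPolynomial ℕ ℂ) :
    expCreation η α n v = schur η n * v := by
  have h : creationSeries η α = PowerSeries.map
      ((Algebra.lmul ℂ (MvPolynomial ℕ ℂ) : _ →ₐ[ℂ] _) : _ →+* _) (powerSumSeries η) := by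
    ext1 n
    rw [creationSeries, powerSumSeries, PowerSeries.coeff_map, PowerSeries.coeff_mk,
      PowerSeries.coeff_mk]
    split_ifs with h
    · simp
    · rw [RingHom.coe_coe, map_smul, heisMode, if_pos (by omega)]
      congr 1
      have : (- -(n : ℤ) - 1).toNat = n - 1 := by omega
      rw [this]
      rfl
  rw [expCreation, schur]
  split_ifs
  · rw [zero_mul, LinearMap.zero_apply]
  · rw [h, expSeries_map, PowerSeries.coeff_map]
    rfl

/-! ### The annihilation part -/

theorem annihSeries_coeff_zero (η α : ℂ) : PowerSeries.coeff 0 (annihSeries η α) = 0 := by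
  simp [annihSeries]

/-- The factor n + 1 in j(n+1) = (n+1) ∂/∂x_n cancels the denominator in the exponent. -/
theorem coeff_annihSeries_succ (η α : ℂ) (n : ℕ) (v : MvPolynomial ℕ ℂ) :
    PowerSeries.coeff (n + 1) (annihSeries η α) v = -(η • MvPolynomial.pderiv n v) := by
  rw [annihSeries, PowerSeries.coeff_mk, if_neg (by omega), heisMode, if_neg (by omega),
    if_neg (by omega)]
  have : (((n + 1 : ℕ) : ℤ) - 1).toNat = n := by omega
  rw [this, smul_smul, LinearMap.smul_apply, Int.cast_natCast, neg_mul,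
    div_mul_cancel₀ _ (Nat.cast_ne_zero.mpr (Nat.succ_ne_zero n)), neg_smul]
  rfl

theorem expAnnih_one (η α : ℂ) (m : ℕ) :
    expAnnih η α m (1 : MvPolynomial ℕ ℂ) = if m = 0 then 1 else 0 := by
  have h : ∀ m k : ℕ,
      PowerSeries.coeff m (annihSeries η α ^ (k + 1)) (1 : MvPolynomial ℕ ℂ) = 0 := by
    intro m k
    rw [pow_succ, PowerSeries.coeff_mul, LinearMap.sum_apply]
    refine Finset.sum_eq_zero fun p _ => ?_
    rw [Module.End.mul_apply]
    rcases p with ⟨i, _ | j⟩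
    · rw [annihSeries_coeff_zero, LinearMap.zero_apply, map_zero]
    · rw [coeff_annihSeries_succ, MvPolynomial.pderiv_one, smul_zero, neg_zero, map_zero]
  rw [expAnnih, expSeries, PowerSeries.coeff_mk, LinearMap.sum_apply, Finset.sum_range_succ',
    Finset.sum_eq_zero fun k _ => by rw [LinearMap.smul_apply, h, smul_zero], zero_add,
    LinearMap.smul_apply, pow_zero, PowerSeries.coeff_one, Nat.factorial_zero]
  split_ifs <;> simp

/-- Multiplication by the variable `x_n` as a constant power series. -/
def mulXSeries (n : ℕ) : PowerSeries (Module.End ℂ (MvPolynomial ℕ ℂ)) :=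
  PowerSeries.C (LinearMap.mulLeft ℂ (MvPolynomial.X n))

/-- The series variable stands for z⁻¹. Since [∂_m, x_n] = δ_{m,n}, the commutator is the central
term -η z^(-n-1). -/
theorem annihSeries_mul_mulX (η α : ℂ) (n : ℕ) :
    annihSeries η α * mulXSeries n =
      mulXSeries n * annihSeries η α - η • PowerSeries.X ^ (n + 1) := by
  ext1 m
  refine LinearMap.ext fun v => ?_
  rw [mulXSeries, PowerSeries.coeff_mul_C, map_sub, PowerSeries.coeff_C_mul,
    PowerSeries.coeff_smul, PowerSeries.coeff_X_pow, LinearMap.sub_apply, Module.End.mul_apply,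
    Module.End.mul_apply, LinearMap.smul_apply]
  cases m with
  | zero => simp [annihSeries_coeff_zero]
  | succ m =>
    rw [coeff_annihSeries_succ, coeff_annihSeries_succ, LinearMap.mulLeft_apply,
      LinearMap.mulLeft_apply, Derivation.leibniz, MvPolynomial.pderiv_X]
    by_cases h : m = n
    · subst h
      simp
      ring
    · have h' : ¬ n = m := fun e => h e.symm
      simp [h]

/-- Centrality of the commutator makes it come out of a power by the Leibniz rule. -/
theorem annihSeries_pow_mul_mulX (η α : ℂ) (n k : ℕ) :
    annihSeries η α ^ (k + 1) * mulXSeries n = mulXSeries n * annihSeries η α ^ (k + 1) -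
      (((k + 1 : ℕ) : ℂ) * η) • (PowerSeries.X ^ (n + 1) * annihSeries η α ^ k) := by
  induction k with
  | zero => simpa using annihSeries_mul_mulX η α n
  | succ k ih =>
    have hX := (PowerSeries.commute_X_pow (annihSeries η α) (n + 1)).eq
    rw [pow_succ' _ (k + 1), mul_assoc, ih, mul_sub, ← mul_assoc, annihSeries_mul_mulX, sub_mul,
      mul_smul_comm, ← mul_assoc (annihSeries η α) (PowerSeries.X ^ (n + 1)), hX, mul_assoc,
      mul_assoc (PowerSeries.X ^ (n + 1)) (annihSeries η α), ← pow_succ' (annihSeries η α) k,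
      smul_mul_assoc, sub_sub, ← add_smul]
    congr 2
    push_cast
    ring

/-- Division by factorials and summation give exp(A) x_n = (x_n - η z^(-n-1)) exp(A) for the
annihilation exponent A. -/
theorem expAnnih_X_mul (η α : ℂ) (m n : ℕ) (v : MvPolynomial ℕ ℂ) :
    expAnnih η α m (MvPolynomial.X n * v) = MvPolynomial.X n * expAnnih η α m v -
      η • if n + 1 ≤ m then expAnnih η α (m - (n + 1)) v else 0 := by
  have key : PowerSeries.coeff m (expSeries (annihSeries η α)) *
        LinearMap.mulLeft ℂ (MvPolynomial.X n) =
      LinearMap.mulLeft ℂ (MvPolynomial.X n) *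
        PowerSeries.coeff m (expSeries (annihSeries η α)) -
      η • if n + 1 ≤ m then
        PowerSeries.coeff (m - (n + 1)) (expSeries (annihSeries η α)) else 0 := by
    -- One extra term is kept on the left because the commutator lowers the power of the series by
    -- one.
    rw [coeff_expSeries (annihSeries_coeff_zero η α) (show m < m + 1 + 1 by omega),
      Finset.sum_mul, Finset.mul_sum, Finset.sum_range_succ', Finset.sum_range_succ' (n := m + 1)]
    have h1 : (if n + 1 ≤ m then
        PowerSeries.coeff (m - (n + 1)) (expSeries (annihSeries η α)) else 0) =
        ∑ k ∈ Finset.range (m + 1), ((k.factorial : ℂ)⁻¹) •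
          PowerSeries.coeff m (PowerSeries.X ^ (n + 1) * annihSeries η α ^ k) := by
      split_ifs with h
      · rw [coeff_expSeries (annihSeries_coeff_zero η α) (show m - (n + 1) < m + 1 by omega)]
        simp only [PowerSeries.coeff_X_pow_mul', if_pos h]
      · simp only [PowerSeries.coeff_X_pow_mul', if_neg h, smul_zero, Finset.sum_const_zero]
    have h2 : ∀ k : ℕ, (((k + 1).factorial : ℂ)⁻¹) •
          PowerSeries.coeff m (annihSeries η α ^ (k + 1)) *
          LinearMap.mulLeft ℂ (MvPolynomial.X n) =
        LinearMap.mulLeft ℂ (MvPolynomial.X n) * (((k + 1).factorial : ℂ)⁻¹) •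
          PowerSeries.coeff m (annihSeries η α ^ (k + 1)) -
        η • ((k.factorial : ℂ)⁻¹) •
          PowerSeries.coeff m (PowerSeries.X ^ (n + 1) * annihSeries η α ^ k) := by
      intro k
      have := congrArg (PowerSeries.coeff m) (annihSeries_pow_mul_mulX η α n k)
      rw [mulXSeries, PowerSeries.coeff_mul_C, map_sub, PowerSeries.coeff_C_mul,
        PowerSeries.coeff_smul] at this
      rw [smul_mul_assoc, this, smul_sub, mul_smul_comm, smul_smul, smul_smul]
      congr 2
      have hk := Nat.cast_ne_zero (R := ℂ).mpr (Nat.succ_ne_zero k)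
      rw [Nat.factorial_succ, Nat.cast_mul, mul_inv, mul_comm η]
      field_simp
    rw [h1, Finset.sum_congr rfl fun k _ => h2 k, Finset.sum_sub_distrib, Finset.smul_sum]
    have h3 : ((Nat.factorial 0 : ℂ)⁻¹) • PowerSeries.coeff m (annihSeries η α ^ 0) *
          LinearMap.mulLeft ℂ (MvPolynomial.X n) =
        LinearMap.mulLeft ℂ (MvPolynomial.X n) *
          ((Nat.factorial 0 : ℂ)⁻¹) • PowerSeries.coeff m (annihSeries η α ^ 0) := by
      rw [pow_zero, PowerSeries.coeff_one]
      split_ifs <;> simp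
    rw [h3]
    abel
  have h := LinearMap.congr_fun key v
  rw [Module.End.mul_apply, LinearMap.mulLeft_apply, LinearMap.sub_apply, Module.End.mul_apply,
    LinearMap.mulLeft_apply, LinearMap.smul_apply] at h
  rw [expAnnih, h]
  split_ifs <;> rfl

/-! ### Components of vertex operators -/

/-- The component `X_η(p)` as an endomorphism of the space underlying all the `H_α`. -/
def vertexEnd (η α : ℂ) (p : ℤ) : Module.End ℂ (MvPolynomial ℕ ℂ) := vertexMode η α p

/-- Stated for every large cut-off, so that sums for different modes and vectors can be truncated
together. -/
theorem vertexEnd_eq_sum (η α : ℂ) (p : ℤ) (v : MvPolynomial ℕ ℂ) :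
    ∃ d, ∀ M, d ≤ M → vertexEnd η α p v =
      ∑ m ∈ Finset.range M, schur η (m - p) * expAnnih η α m v := by
  obtain ⟨d, hd⟩ := expAnnih_eventually η α v
  refine ⟨d + 1, fun M hM => ?_⟩
  rw [vertexEnd, vertexMode, locFinSum_apply, finsum_eq_sum_of_support_subset (s := Finset.range M)]
  · exact Finset.sum_congr rfl fun m _ => expCreation_apply η α _ _
  · intro m hm
    by_contra hcon
    simp only [Finset.coe_range, Set.mem_Iio, not_lt] at hcon
    refine hm ?_
    change expCreation η α (m - p) (expAnnih η α m v) = 0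
    rw [hd m (by omega), map_zero]

theorem vertexEnd_one (η α : ℂ) (p : ℤ) :
    vertexEnd η α p 1 = schur η (-p) := by
  obtain ⟨d, hd⟩ := vertexEnd_eq_sum η α p 1
  rw [hd (d + 1) (by omega), Finset.sum_range_succ', Finset.sum_eq_zero]
  · simp [expAnnih_one]
  · intro m _
    rw [expAnnih_one, if_neg (by omega), mul_zero]

theorem sum_range_shift (f : ℤ → MvPolynomial ℕ ℂ) (g g' : ℕ → MvPolynomial ℕ ℂ) (η : ℂ)
    (n M : ℕ) (x : MvPolynomial ℕ ℂ)
    (hg : ∀ m, g' m = x * g m - η • if n + 1 ≤ m then g (m - (n + 1)) else 0) (p : ℤ) :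
    ∑ m ∈ Finset.range (M + (n + 1)), f (m - p) * g' m =
      x * ∑ m ∈ Finset.range (M + (n + 1)), f (m - p) * g m -
        η • ∑ m ∈ Finset.range M, f (m - (p - n - 1)) * g m := by
  have h1 : ∀ m ∈ Finset.range (M + (n + 1)), f (m - p) * g' m = x * (f (m - p) * g m) -
      η • (f (m - p) * if n + 1 ≤ m then g (m - (n + 1)) else 0) := by
    intro m _
    rw [hg, mul_sub, mul_left_comm, mul_smul_comm]
  have h2 : ∑ m ∈ Finset.range (M + (n + 1)),
      (f (m - p) * if n + 1 ≤ m then g (m - (n + 1)) else 0) =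
      ∑ m ∈ Finset.range M, f (m - (p - n - 1)) * g m := by
    rw [add_comm M (n + 1), Finset.sum_range_add, Finset.sum_eq_zero, zero_add]
    · refine Finset.sum_congr rfl fun m _ => ?_
      rw [if_pos (by omega), Nat.add_sub_cancel_left]
      congr 2
      push_cast
      ring
    · intro m hm
      simp only [Finset.mem_range] at hm
      rw [if_neg (by omega), mul_zero]
  rw [Finset.sum_congr rfl h1, Finset.sum_sub_distrib, ← Finset.smul_sum, ← Finset.mul_sum, h2]

/-- The creation exponential commutes with x_n, so the rule for the annihilation exponential passes
to the whole vertex operator. Together with the value on 1 it determines the operator. -/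
theorem vertexEnd_X_mul (η α : ℂ) (p : ℤ) (n : ℕ) (v : MvPolynomial ℕ ℂ) :
    vertexEnd η α p (MvPolynomial.X n * v) =
      MvPolynomial.X n * vertexEnd η α p v - η • vertexEnd η α (p - n - 1) v := by
  obtain ⟨d₁, h₁⟩ := vertexEnd_eq_sum η α p (MvPolynomial.X n * v)
  obtain ⟨d₂, h₂⟩ := vertexEnd_eq_sum η α p v
  obtain ⟨d₃, h₃⟩ := vertexEnd_eq_sum η α (p - n - 1) v
  rw [h₁ (d₁ + d₂ + d₃ + (n + 1)) (by omega), h₂ (d₁ + d₂ + d₃ + (n + 1)) (by omega),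
    h₃ (d₁ + d₂ + d₃) (by omega)]
  exact sum_range_shift (schur η) (fun m => expAnnih η α m v)
    (fun m => expAnnih η α m (MvPolynomial.X n * v)) η n (d₁ + d₂ + d₃) (MvPolynomial.X n)
    (fun m => expAnnih_X_mul η α m n v) p

/-- The component `X_η(p)` on `H_0`; the operators on the other `H_α` are the same. -/
def vertexOp (η : ℂ) (p : ℤ) : Module.End ℂ (MvPolynomial ℕ ℂ) := vertexEnd η 0 p

theorem vertexOp_one (η : ℂ) (p : ℤ) : vertexOp η p 1 = schur η (-p) := vertexEnd_one η 0 p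

theorem vertexOp_X_mul (η : ℂ) (p : ℤ) (n : ℕ) (v : MvPolynomial ℕ ℂ) :
    vertexOp η p (MvPolynomial.X n * v) =
      MvPolynomial.X n * vertexOp η p v - η • vertexOp η (p - n - 1) v :=
  vertexEnd_X_mul η 0 p n v

/-- Both sides obey the two rules that determine a vertex operator, and neither rule involves α. -/
theorem vertexMode_eq_vertexOp (η α : ℂ) (p : ℤ) (v : MvPolynomial ℕ ℂ) :
    vertexMode η α p v = vertexOp η p v := by
  change vertexEnd η α p v = vertexOp η p v
  induction v using MvPolynomial.induction_on generalizing p with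
  | C a =>
    rw [← mul_one (MvPolynomial.C a), ← MvPolynomial.smul_eq_C_mul, map_smul, map_smul,
      vertexEnd_one, vertexOp_one]
  | add v w hv hw => rw [map_add, map_add, hv, hw]
  | mul_X v n hv => rw [mul_comm, vertexEnd_X_mul, vertexOp_X_mul, hv, hv]

theorem vertexOp_eventually (η : ℂ) (v : MvPolynomial ℕ ℂ) :
    ∃ d : ℤ, ∀ n, d < n → vertexOp η n v = 0 := vertexMode_eventually η 0 v

/-- Two vertex operators of opposite exponents: `X_η(z) X_{-η}(w)` applied to the vacuum is
`(1 - w/z) h_η(z) h_{-η}(w)` when `η² = -1`. -/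
theorem vertexOp_schur_neg {η : ℂ} (hη : η * η = -1) (p a : ℤ) :
    vertexOp η p (schur (-η) a) =
      schur η (-p) * schur (-η) a - schur η (1 - p) * schur (-η) (a - 1) := by
  rcases lt_or_ge a 0 with ha | ha
  · rw [schur_neg _ ha, schur_neg _ (by omega : a - 1 < 0), map_zero, mul_zero, mul_zero, sub_zero]
  lift a to ℕ using ha
  induction a using Nat.strong_induction_on generalizing p with
  | _ a ih =>
  rcases Nat.eq_zero_or_pos a with rfl | hpos
  · rw [Nat.cast_zero, schur_zero, vertexOp_one, schur_neg _ (by omega : (0 : ℤ) - 1 < 0), mul_one,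
      mul_zero, sub_zero]
  have ha : (a : ℂ) ≠ 0 := Nat.cast_ne_zero.mpr (by omega)
  refine (smul_right_inj ha).mp ?_
  rw [← map_smul, schur_rec, map_smul, map_sum]
  -- By induction, the corrections that covariance produces are differences of consecutive terms, so
  -- their sum over n telescopes.
  have h1 : ∀ n ∈ Finset.range a,
      vertexOp η p (MvPolynomial.X n * schur (-η) ((a : ℤ) - 1 - n)) =
      (schur η (-p) * (MvPolynomial.X n * schur (-η) ((a : ℤ) - 1 - n)) -
        schur η (1 - p) * (MvPolynomial.X n * schur (-η) ((a : ℤ) - 1 - n - 1))) -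
      η • ((schur η (1 + n - p) * schur (-η) ((a : ℤ) - 1 - n)) -
        schur η (1 + (n + 1 : ℕ) - p) * schur (-η) ((a : ℤ) - 1 - (n + 1 : ℕ))) := by
    intro n hn
    simp only [Finset.mem_range] at hn
    have e : (a : ℤ) - 1 - n = ((a - 1 - n : ℕ) : ℤ) := by omega
    have i1 := ih (a - 1 - n) (by omega) p
    have i2 := ih (a - 1 - n) (by omega) (p - n - 1)
    rw [← e] at i1 i2
    rw [vertexOp_X_mul, i1, i2, show -(p - n - 1) = 1 + (n : ℤ) - p by ring,
      show 1 - (p - n - 1) = 1 + ((n + 1 : ℕ) : ℤ) - p by push_cast; ring,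
      show (a : ℤ) - 1 - (n + 1 : ℕ) = (a : ℤ) - 1 - n - 1 by push_cast; ring]
    ring
  rw [Finset.sum_congr rfl h1, Finset.sum_sub_distrib, Finset.sum_sub_distrib, ← Finset.mul_sum,
    ← Finset.mul_sum, ← Finset.smul_sum, Finset.sum_range_sub', smul_sub, smul_sub,
    ← mul_smul_comm, ← schur_rec, ← mul_smul_comm]
  -- The recursion in degree a - 1 gives only the weight a - 1; the telescoped end term supplies the
  -- missing unit because η² = -1.
  have h2 : (-η) • ∑ n ∈ Finset.range a,
      MvPolynomial.X n * schur (-η) ((a : ℤ) - 1 - n - 1) =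
      ((a : ℂ) - 1) • schur (-η) ((a : ℤ) - 1) := by
    obtain ⟨b, rfl⟩ : ∃ b, a = b + 1 := ⟨a - 1, by omega⟩
    have := schur_rec (-η) b
    rw [Finset.sum_range_succ, schur_neg _ (by push_cast; omega), mul_zero, add_zero,
      show ((b + 1 : ℕ) : ℂ) - 1 = b by push_cast; ring,
      show ((b + 1 : ℕ) : ℤ) - 1 = b by push_cast; ring, this]
    congr 1
    exact Finset.sum_congr rfl fun n _ => by rw [sub_right_comm]
  rw [h2, schur_neg (-η) (by omega : (a : ℤ) - 1 - (a : ℕ) < 0), mul_zero, sub_zero, smul_smul,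
    neg_mul, hη, neg_neg, one_smul, Nat.cast_zero, add_zero, sub_zero, smul_sub, mul_smul_comm,
    mul_smul_comm, sub_smul, one_smul]
  abel

/-- Two vertex operators of equal exponents: `(1 - w/z) X_η(z) X_η(w)` applied to the vacuum is
`h_η(z) h_η(w)` when `η² = -1`. -/
theorem vertexOp_schur_self {η : ℂ} (hη : η * η = -1) (p a : ℤ) :
    vertexOp η p (schur η a) - vertexOp η (p - 1) (schur η (a - 1)) =
      schur η (-p) * schur η a := by
  rcases lt_or_ge a 0 with ha | ha
  · rw [schur_neg _ ha, schur_neg _ (by omega : a - 1 < 0), map_zero, map_zero, mul_zero, sub_zero]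
  lift a to ℕ using ha
  induction a using Nat.strong_induction_on generalizing p with
  | _ a ih =>
  rcases Nat.eq_zero_or_pos a with rfl | hpos
  · rw [Nat.cast_zero, schur_zero, vertexOp_one, schur_neg _ (by omega : (0 : ℤ) - 1 < 0), mul_one,
      map_zero, sub_zero]
  have ha : (a : ℂ) ≠ 0 := Nat.cast_ne_zero.mpr (by omega)
  refine (smul_right_inj ha).mp ?_
  have h2 : η • ∑ n ∈ Finset.range a,
      MvPolynomial.X n * schur η ((a : ℤ) - 1 - n - 1) =
      ((a : ℂ) - 1) • schur η ((a : ℤ) - 1) := by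
    obtain ⟨b, rfl⟩ : ∃ b, a = b + 1 := ⟨a - 1, by omega⟩
    have := schur_rec η b
    rw [Finset.sum_range_succ, schur_neg _ (by push_cast; omega), mul_zero, add_zero,
      show ((b + 1 : ℕ) : ℂ) - 1 = b by push_cast; ring,
      show ((b + 1 : ℕ) : ℤ) - 1 = b by push_cast; ring, this]
    congr 1
    exact Finset.sum_congr rfl fun n _ => by rw [sub_right_comm]
  -- Splitting a = (a - 1) + 1 makes the recursion in degree a - 1 applicable; the leftover unit
  -- cancels the telescoped term since η² = -1.
  have h3 : (a : ℂ) • vertexOp η (p - 1) (schur η ((a : ℤ) - 1)) =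
      vertexOp η (p - 1) (η • ∑ n ∈ Finset.range a,
        MvPolynomial.X n * schur η ((a : ℤ) - 1 - n - 1)) +
      vertexOp η (p - 1) (schur η ((a : ℤ) - 1)) := by
    rw [h2, map_smul, sub_smul, one_smul, sub_add_cancel]
  have h1 : ∀ n ∈ Finset.range a,
      vertexOp η p (MvPolynomial.X n * schur η ((a : ℤ) - 1 - n)) -
        vertexOp η (p - 1) (MvPolynomial.X n * schur η ((a : ℤ) - 1 - n - 1)) =
      schur η (-p) * (MvPolynomial.X n * schur η ((a : ℤ) - 1 - n)) -
      η • (vertexOp η (p - 1 - n) (schur η ((a : ℤ) - 1 - n)) -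
        vertexOp η (p - 1 - (n + 1 : ℕ)) (schur η ((a : ℤ) - 1 - (n + 1 : ℕ)))) := by
    intro n hn
    simp only [Finset.mem_range] at hn
    have e : (a : ℤ) - 1 - n = ((a - 1 - n : ℕ) : ℤ) := by omega
    have i1 := ih (a - 1 - n) (by omega) p
    rw [← e] at i1
    rw [vertexOp_X_mul, vertexOp_X_mul, mul_left_comm, ← i1,
      show p - n - 1 = p - 1 - (n : ℤ) by ring,
      show p - 1 - n - 1 = p - 1 - ((n + 1 : ℕ) : ℤ) by push_cast; ring,
      show (a : ℤ) - 1 - (n + 1 : ℕ) = (a : ℤ) - 1 - n - 1 by push_cast; ring, mul_sub, smul_sub]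
    abel
  rw [smul_sub, h3, ← map_smul, schur_rec, map_smul, map_sum, map_smul, map_sum, ← sub_sub,
    ← smul_sub, ← Finset.sum_sub_distrib, Finset.sum_congr rfl h1, Finset.sum_sub_distrib,
    ← Finset.mul_sum, ← Finset.smul_sum, Finset.sum_range_sub', smul_sub, ← mul_smul_comm,
    ← schur_rec, schur_neg η (by omega : (a : ℤ) - 1 - (a : ℕ) < 0), map_zero, sub_zero, smul_smul,
    hη, neg_smul, one_smul, Nat.cast_zero, sub_zero, sub_zero, mul_smul_comm, sub_neg_eq_add,
    add_sub_cancel_right]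

/-- `X_η(p-1) X_η(q) + X_η(q-1) X_η(p)`, applied to the vacuum, depends on `p + q` only. -/
theorem vertexOp_schur_symm {η : ℂ} (hη : η * η = -1) (p q p' q' : ℤ) (h : p + q = p' + q') :
    vertexOp η (p - 1) (schur η (-q)) + vertexOp η (q - 1) (schur η (-p)) =
      vertexOp η (p' - 1) (schur η (-q')) + vertexOp η (q' - 1) (schur η (-p')) := by
  -- Two instances of `vertexOp_schur_self` have the same right side h_(-p) h_(1-q), because
  -- polynomials commute. Equating their left sides moves one unit from q to p.
  have step : ∀ p q : ℤ,
      vertexOp η (p - 1) (schur η (-q)) + vertexOp η (q - 1) (schur η (-p)) =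
      vertexOp η (p + 1 - 1) (schur η (-(q - 1))) +
        vertexOp η (q - 1 - 1) (schur η (-(p + 1))) := by
    intro p q
    have h1 := vertexOp_schur_self hη (q - 1) (-p)
    have h2 := vertexOp_schur_self hη p (1 - q)
    rw [show 1 - q - 1 = -q by ring] at h2
    rw [show -(q - 1) = 1 - q by ring] at h1 ⊢
    rw [mul_comm, ← h2, show -p - 1 = -(p + 1) by ring] at h1
    rw [add_sub_cancel_right, eq_comm, ← sub_eq_zero]
    rw [← sub_eq_zero] at h1
    rw [← neg_eq_zero, ← h1]
    abel
  have key : ∀ (n : ℕ) (p q : ℤ),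
      vertexOp η (p - 1) (schur η (-q)) + vertexOp η (q - 1) (schur η (-p)) =
      vertexOp η (p + n - 1) (schur η (-(q - n))) +
        vertexOp η (q - n - 1) (schur η (-(p + n))) := by
    intro n
    induction n with
    | zero => intro p q; simp
    | succ n ih =>
      intro p q
      rw [ih, step, Nat.cast_succ, add_assoc, sub_sub]
  rcases le_total p p' with hp | hp
  · have := key (p' - p).toNat p q
    rwa [show p + ((p' - p).toNat : ℤ) = p' by omega,
      show q - ((p' - p).toNat : ℤ) = q' by omega] at this
  · have := key (p - p').toNat p' q'
    rw [show p' + ((p - p').toNat : ℤ) = p by omega,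
      show q' - ((p - p').toNat : ℤ) = q by omega] at this
    exact this.symm

/-! ### Products of a fermionic field and a vertex operator -/

/-- The tensor product of the `bc` Fock space with the space underlying all the `H_α`. -/
abbrev FullFock : Type := BCFock ⊗[ℂ] MvPolynomial ℕ ℂ

/-- A family of modes such that every vector is annihilated by all large modes. -/
def IsField (D : ℤ → Module.End ℂ BCFock) : Prop := ∀ v, ∃ d : ℤ, ∀ k, d < k → D k v = 0

/-- The component of degree `r` of the product of the field `∑ D(k) z^(-k)` and `X_η(z)`. -/
def modeSum {D : ℤ → Module.End ℂ BCFock} (hD : IsField D) (η : ℂ) (r : ℤ) :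
    Module.End ℂ FullFock :=
  locFinSum (fun k : ℤ => TensorProduct.map (D k) (vertexOp η (r - k)))
    (tensor_finite D (vertexOp η) hD (vertexOp_eventually η) r)

/-- With the window eventual in M, several such sums can be taken over the same window. -/
theorem modeSum_eventually {D : ℤ → Module.End ℂ BCFock} (hD : IsField D) (η : ℂ) (r : ℤ)
    (t : FullFock) : ∀ᶠ M : ℕ in Filter.atTop, modeSum hD η r t =
      ∑ k ∈ Finset.Icc (-M : ℤ) M, TensorProduct.map (D k) (vertexOp η (r - k)) t := by
  have hfin := tensor_finite D (vertexOp η) hD (vertexOp_eventually η) r t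
  obtain ⟨a, ha⟩ := hfin.bddAbove
  obtain ⟨b, hb⟩ := hfin.bddBelow
  filter_upwards [Filter.eventually_ge_atTop (a.natAbs + b.natAbs)] with M hM
  rw [modeSum, locFinSum_apply, finsum_eq_sum_of_support_subset]
  intro k hk
  have h1 := ha hk
  have h2 := hb hk
  simp only [Finset.coe_Icc, Set.mem_Icc]
  omega

theorem modeSum_tmul_one {D : ℤ → Module.End ℂ BCFock} (hD : IsField D) (η : ℂ) (r : ℤ)
    (v : BCFock) : ∀ᶠ M : ℕ in Filter.atTop, modeSum hD η r (v ⊗ₜ 1) =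
      ∑ k ∈ Finset.Icc (-M : ℤ) M, D k v ⊗ₜ schur η (k - r) := by
  filter_upwards [modeSum_eventually hD η r (v ⊗ₜ 1)] with M hM
  rw [hM]
  refine Finset.sum_congr rfl fun k _ => ?_
  rw [TensorProduct.map_tmul, vertexOp_one, neg_sub]

theorem modeSum_modeSum_tmul_one {D D' : ℤ → Module.End ℂ BCFock} (hD : IsField D)
    (hD' : IsField D') (η η' : ℂ) (r r' : ℤ) (v : BCFock) : ∀ᶠ M : ℕ in Filter.atTop,
      modeSum hD η r (modeSum hD' η' r' (v ⊗ₜ 1)) =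
        ∑ k ∈ Finset.Icc (-M : ℤ) M, ∑ k' ∈ Finset.Icc (-M : ℤ) M,
          D k (D' k' v) ⊗ₜ vertexOp η (r - k) (schur η' (k' - r')) := by
  filter_upwards [modeSum_tmul_one hD' η' r' v,
    modeSum_eventually hD η r (modeSum hD' η' r' (v ⊗ₜ 1))] with M h1 h2
  rw [h2]
  refine Finset.sum_congr rfl fun k _ => ?_
  rw [h1, map_sum]
  rfl

/-- Multiplication of the second tensor factor by `x_a`. -/
def mulX (a : ℕ) : Module.End ℂ FullFock :=
  TensorProduct.map LinearMap.id (LinearMap.mulLeft ℂ (MvPolynomial.X a))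

theorem mulX_tmul (a : ℕ) (v : BCFock) (w : MvPolynomial ℕ ℂ) :
    mulX a (v ⊗ₜ w) = v ⊗ₜ (MvPolynomial.X a * w) := rfl

/-- Only the vertex factor fails to commute with x_a, so its covariance is inherited by the product.
-/
theorem mulX_modeSum {D : ℤ → Module.End ℂ BCFock} (hD : IsField D) (η : ℂ) (r : ℤ) (a : ℕ)
    (t : FullFock) : mulX a (modeSum hD η r t) =
      modeSum hD η r (mulX a t) + η • modeSum hD η (r - a - 1) t := by
  obtain ⟨M, h1, h2, h3⟩ := ((modeSum_eventually hD η r t).and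
    ((modeSum_eventually hD η r (mulX a t)).and
      (modeSum_eventually hD η (r - a - 1) t))).exists
  rw [h1, h2, h3, map_sum, Finset.smul_sum, ← Finset.sum_add_distrib]
  refine Finset.sum_congr rfl fun k _ => ?_
  clear h1 h2 h3
  induction t using TensorProduct.induction_on with
  | zero => simp
  | tmul v w =>
    rw [mulX_tmul, TensorProduct.map_tmul, TensorProduct.map_tmul, TensorProduct.map_tmul,
      mulX_tmul, vertexOp_X_mul, ← TensorProduct.tmul_smul, ← TensorProduct.tmul_add,
      show r - a - 1 - k = r - k - a - 1 by ring, sub_add_cancel]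
  | add x y hx hy =>
    simp only [map_add, smul_add]
    rw [hx, hy]
    abel

/-- A family of operators which is covariant under the multiplications by the `x_a` vanishes if it
annihilates all vectors `v ⊗ 1`. -/
theorem eq_zero_of_covariant (Q : ℤ → ℤ → Module.End ℂ FullFock) (c c' : ℂ)
    (hQ : ∀ p q a t, mulX a (Q p q t) =
      Q p q (mulX a t) + c • Q (p - a - 1) q t + c' • Q p (q - a - 1) t)
    (h1 : ∀ p q v, Q p q (v ⊗ₜ 1) = 0) (p q : ℤ) : Q p q = 0 := by
  refine TensorProduct.ext' fun v w => ?_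
  rw [LinearMap.zero_apply]
  induction w using MvPolynomial.induction_on generalizing p q with
  | C a =>
    rw [← mul_one (MvPolynomial.C a), ← MvPolynomial.smul_eq_C_mul, TensorProduct.tmul_smul,
      map_smul, h1, smul_zero]
  | add w w' hw hw' => rw [TensorProduct.tmul_add, map_add, hw, hw', add_zero]
  | mul_X w n hw =>
    have := hQ p q n (v ⊗ₜ w)
    rw [hw, hw, hw, map_zero, smul_zero, smul_zero, add_zero, add_zero, mulX_tmul] at this
    rw [mul_comm, ← this]

theorem sum_sum_eq_zero_of_antisymm (I : Finset ℤ) (f : ℤ → ℤ → FullFock)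
    (hf : ∀ a b, f a b = -f b a) : ∑ a ∈ I, ∑ b ∈ I, f a b = 0 := by
  have h : ∑ a ∈ I, ∑ b ∈ I, f a b = -∑ a ∈ I, ∑ b ∈ I, f a b := by
    conv_lhs => rw [Finset.sum_comm]
    rw [← Finset.sum_neg_distrib]
    refine Finset.sum_congr rfl fun a _ => ?_
    rw [← Finset.sum_neg_distrib]
    exact Finset.sum_congr rfl fun b _ => hf b a
  have h2 : (2 : ℂ) • ∑ a ∈ I, ∑ b ∈ I, f a b = 0 := by
    rw [two_smul]
    nth_rw 1 [h]
    exact neg_add_cancel _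
  exact (smul_eq_zero.mp h2).resolve_left two_ne_zero

/-- On v ⊗ 1 the difference of the two sides is a double sum of D(a) D(b) v tensored with a bosonic
factor symmetric in a and b, by `vertexOp_schur_symm`. The D(a) anticommute, so the summand is
antisymmetric. -/
theorem modeSum_comm_self {D : ℤ → Module.End ℂ BCFock} (hD : IsField D) {η : ℂ} (hη : η * η = -1)
    (hDD : ∀ k k' v, D k (D k' v) = -D k' (D k v)) (p q : ℤ) :
    modeSum hD η p * modeSum hD η (q + 1) = modeSum hD η q * modeSum hD η (p + 1) := by
  rw [← sub_eq_zero]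
  refine eq_zero_of_covariant (fun p q => modeSum hD η p * modeSum hD η (q + 1) -
    modeSum hD η q * modeSum hD η (p + 1)) η η (fun p q a t => ?_) (fun p q v => ?_) p q
  · simp only [LinearMap.sub_apply, Module.End.mul_apply, map_sub, mulX_modeSum, map_add, map_smul,
      smul_sub]
    rw [show q - a - 1 + 1 = q + 1 - a - 1 by ring, show p - a - 1 + 1 = p + 1 - a - 1 by ring]
    abel
  · obtain ⟨M, h1, h2⟩ := ((modeSum_modeSum_tmul_one hD hD η η p (q + 1) v).and
      (modeSum_modeSum_tmul_one hD hD η η q (p + 1) v)).exists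
    rw [LinearMap.sub_apply, Module.End.mul_apply, Module.End.mul_apply, h1, h2,
      Finset.sum_comm (s := Finset.Icc (-M : ℤ) M) (t := Finset.Icc (-M : ℤ) M)
        (f := fun k k' => D k (D k' v) ⊗ₜ vertexOp η (q - k) (schur η (k' - (p + 1)))),
      ← Finset.sum_sub_distrib]
    simp only [← Finset.sum_sub_distrib]
    refine sum_sum_eq_zero_of_antisymm _ _ fun a b => ?_
    have h := vertexOp_schur_symm hη (p - a + 1) (q - b + 1) (p - b + 1) (q - a + 1) (by ring)
    simp only [add_sub_cancel_right] at h
    rw [show -(q - b + 1) = b - (q + 1) by ring, show -(p - a + 1) = a - (p + 1) by ring,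
      show -(q - a + 1) = a - (q + 1) by ring, show -(p - b + 1) = b - (p + 1) by ring] at h
    rw [hDD b a, TensorProduct.neg_tmul, TensorProduct.neg_tmul, sub_neg_eq_add,
      ← TensorProduct.tmul_add, h, TensorProduct.tmul_add]
    abel

/-- The modes `-k b(k)` of `z ∂b(z)`. -/
def dbMode (k : ℤ) : Module.End ℂ BCFock := (-k : ℂ) • bMode k

theorem dbMode_isField : IsField dbMode := fun v => by
  obtain ⟨d, hd⟩ := bMode_eventually v
  exact ⟨d, fun k hk => by rw [dbMode, LinearMap.smul_apply, hd k hk, smul_zero]⟩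

theorem cMode_isField : IsField cMode := cMode_eventually

/-- The components of `z ∂b(z) X_{-i}(z)`. -/
def opB (r : ℤ) : Module.End ℂ FullFock := modeSum dbMode_isField (-Complex.I) r

/-- The components of `c(z) X_i(z)`. -/
def opC (r : ℤ) : Module.End ℂ FullFock := modeSum cMode_isField Complex.I r

theorem cMode_cMode_apply (k k' : ℤ) (v : BCFock) : cMode k (cMode k' v) = -cMode k' (cMode k v) :=
  eq_neg_of_add_eq_zero_left (LinearMap.congr_fun (cMode_anticomm k k') v)

theorem dbMode_dbMode_apply (k k' : ℤ) (v : BCFock) :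
    dbMode k (dbMode k' v) = -dbMode k' (dbMode k v) := by
  have h := eq_neg_of_add_eq_zero_left (LinearMap.congr_fun (bMode_anticomm k k') v)
  simp only [dbMode, LinearMap.smul_apply, map_smul]
  rw [Module.End.mul_apply, Module.End.mul_apply] at h
  rw [h, smul_neg, smul_neg, smul_comm]

theorem cMode_dbMode_apply (k k' : ℤ) (v : BCFock) :
    cMode k (dbMode k' v) + dbMode k' (cMode k v) = if k = -k' then (-k' : ℂ) • v else 0 := by
  have h := LinearMap.congr_fun (bMode_cMode k' k) v
  simp only [dbMode, LinearMap.smul_apply, map_smul]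
  rw [LinearMap.add_apply, Module.End.mul_apply, Module.End.mul_apply] at h
  rw [← smul_add, add_comm, h]
  by_cases hk : k = -k'
  · subst hk; simp
  · rw [if_neg hk, if_neg (by omega), LinearMap.zero_apply, smul_zero]

/-- The shift by one comes from the factor z^(ηα): the inner operator changes α by η, hence the
exponent ηα by η² = -1. -/
theorem opB_comm (p q : ℤ) : opB p * opB (q + 1) = opB q * opB (p + 1) :=
  modeSum_comm_self _ (by rw [neg_mul_neg, Complex.I_mul_I]) dbMode_dbMode_apply p q

theorem opC_comm (p q : ℤ) : opC p * opC (q + 1) = opC q * opC (p + 1) :=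
  modeSum_comm_self _ Complex.I_mul_I cMode_cMode_apply p q

theorem opC_opB_tmul_one (p q : ℤ) (v : BCFock) : ∀ᶠ M : ℕ in Filter.atTop,
    opC (p + 1) (opB q (v ⊗ₜ 1)) =
      ∑ k ∈ Finset.Icc (-M : ℤ) M, ∑ k' ∈ Finset.Icc (-M : ℤ) M, cMode k (dbMode k' v) ⊗ₜ
        (schur Complex.I (k - p - 1) * schur (-Complex.I) (k' - q) -
          schur Complex.I (k - p) * schur (-Complex.I) (k' - q - 1)) := by
  filter_upwards [modeSum_modeSum_tmul_one cMode_isField dbMode_isField Complex.I (-Complex.I)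
    (p + 1) q v] with M hM
  rw [opC, opB, hM]
  refine Finset.sum_congr rfl fun k _ => Finset.sum_congr rfl fun k' _ => ?_
  rw [vertexOp_schur_neg Complex.I_mul_I, show -(p + 1 - k) = k - p - 1 by ring,
    show 1 - (p + 1 - k) = k - p by ring]

/-- The bosonic factor is the negative of the one in `opC_opB_tmul_one`. Hence the commutator of the
product fields involves the anticommutator of c and ∂b. -/
theorem opB_opC_tmul_one (p q : ℤ) (v : BCFock) : ∀ᶠ M : ℕ in Filter.atTop,
    opB (q + 1) (opC p (v ⊗ₜ 1)) =
      ∑ k ∈ Finset.Icc (-M : ℤ) M, ∑ k' ∈ Finset.Icc (-M : ℤ) M, -(dbMode k' (cMode k v) ⊗ₜ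
        (schur Complex.I (k - p - 1) * schur (-Complex.I) (k' - q) -
          schur Complex.I (k - p) * schur (-Complex.I) (k' - q - 1))) := by
  filter_upwards [modeSum_modeSum_tmul_one dbMode_isField cMode_isField (-Complex.I) Complex.I
    (q + 1) p v] with M hM
  rw [opC, opB, hM, Finset.sum_comm]
  refine Finset.sum_congr rfl fun k _ => Finset.sum_congr rfl fun k' _ => ?_
  have h := vertexOp_schur_neg (η := -Complex.I) (by rw [neg_mul_neg, Complex.I_mul_I])
    (q + 1 - k') (k - p)
  rw [neg_neg] at h
  rw [h, show -(q + 1 - k') = k' - q - 1 by ring,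
    show 1 - (q + 1 - k') = k' - q by ring, ← TensorProduct.tmul_neg]
  congr 1
  ring

theorem sum_Icc_telescope {V : Type} [AddCommGroup V] (G : ℤ → V) (M : ℕ) :
    ∑ k ∈ Finset.Icc (-M : ℤ) M, (G k - G (k + 1)) = G (-M) - G (M + 1) := by
  induction M with
  | zero => simp
  | succ M ih =>
    rw [Nat.cast_succ, Finset.sum_Icc_succ_eq_add_endpoints, ih, neg_add, neg_add_cancel_right]
    abel

/-- Summation by parts. -/
theorem sum_Icc_neg_smul_sub {V : Type} [AddCommGroup V] [Module ℂ V] (e : ℤ → V) (M : ℕ)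
    (h1 : e (-M) = 0) (h2 : e (M + 1) = 0) :
    ∑ k ∈ Finset.Icc (-M : ℤ) M, (-k : ℂ) • (e (k + 1) - e k) =
      ∑ k ∈ Finset.Icc (-M : ℤ) M, e k := by
  have h := sum_Icc_telescope (fun k : ℤ => ((k : ℂ) - 1) • e k) M
  rw [h1, h2, smul_zero, smul_zero, sub_zero] at h
  rw [← sub_eq_zero, ← Finset.sum_sub_distrib, ← h]
  refine Finset.sum_congr rfl fun k _ => ?_
  rw [Int.cast_add, Int.cast_one, add_sub_cancel_right, smul_sub, sub_smul, one_smul, neg_smul,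
    neg_smul]
  abel

/-- A coefficient of the product of the mutually inverse series h_η and h_(-η). Nonzero terms need q
≤ k ≤ -p, and the window contains all such k. -/
theorem sum_Icc_schur_mul_schur (η : ℂ) (p q : ℤ) (M : ℕ) (hp : p.natAbs ≤ M)
    (hq : q.natAbs ≤ M) :
    ∑ k ∈ Finset.Icc (-M : ℤ) M, schur η (-k - p) * schur (-η) (k - q) =
      if p + q = 0 then 1 else 0 := by
  rcases lt_or_ge (-p - q) 0 with h | h
  · rw [if_neg (by omega)]
    refine Finset.sum_eq_zero fun k _ => ?_
    rcases lt_or_ge (k - q) 0 with h1 | h1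
    · rw [schur_neg (-η) h1, mul_zero]
    · rw [schur_neg η (by omega), zero_mul]
  · obtain ⟨n, hn⟩ := Int.eq_ofNat_of_zero_le h
    have := sum_schur_mul_schur_neg η n
    simp only [show (p + q = 0) ↔ n = 0 by omega]
    rw [← this]
    refine Finset.sum_bij_ne_zero (fun k _ _ => (-k - p).toNat) ?_ ?_ ?_ ?_
    · intro k hk h0
      have h1 : ¬ k - q < 0 := fun h1 => h0 (by rw [schur_neg (-η) h1, mul_zero])
      have h2 : ¬ -k - p < 0 := fun h2 => h0 (by rw [schur_neg η h2, zero_mul])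
      simp only [Finset.mem_range]
      omega
    · intro k hk h0 k' hk' h0' he
      have h2 : ¬ -k - p < 0 := fun h2 => h0 (by rw [schur_neg η h2, zero_mul])
      have h2' : ¬ -k' - p < 0 := fun h2 => h0' (by rw [schur_neg η h2, zero_mul])
      omega
    · intro i hi h0
      simp only [Finset.mem_range] at hi
      have e1 : - (-p - (i : ℤ)) - p = i := by ring
      have e2 : -p - (i : ℤ) - q = n - i := by omega
      refine ⟨-p - i, ?_, ?_, ?_⟩
      · simp only [Finset.mem_Icc]
        omega
      · rwa [e1, e2]
      · omega
    · intro k hk h0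
      have h2 : ¬ -k - p < 0 := fun h2 => h0 (by rw [schur_neg η h2, zero_mul])
      congr 2 <;> omega

/-- The fermions give a derivative of the delta function and the bosons a simple zero at z = w. In
modes, their product becomes the central term through summation by parts. -/
theorem opC_opB (p q : ℤ) :
    opC (p + 1) * opB q = opB (q + 1) * opC p + if p + q + 1 = 0 then 1 else 0 := by
  suffices key : opC (p + 1) * opB q - opB (q + 1) * opC p - (if p + q + 1 = 0 then 1 else 0) = 0 by
    refine LinearMap.ext fun t => ?_
    have h := LinearMap.congr_fun key t
    rw [LinearMap.sub_apply, LinearMap.sub_apply, LinearMap.zero_apply] at h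
    rw [LinearMap.add_apply]
    exact sub_eq_iff_eq_add'.mp (sub_eq_zero.mp h)
  refine eq_zero_of_covariant (fun p q => opC (p + 1) * opB q - opB (q + 1) * opC p -
    if p + q + 1 = 0 then 1 else 0) Complex.I (-Complex.I) (fun p q a t => ?_)
    (fun p q v => ?_) p q
  · simp only [LinearMap.sub_apply, Module.End.mul_apply, map_sub, opB, opC, mulX_modeSum, map_add,
      map_smul, smul_sub]
    rw [show q - a - 1 + 1 = q + 1 - a - 1 by ring, show p - a - 1 + 1 = p + 1 - a - 1 by ring,
      show p + (q - a - 1) + 1 = p - a - 1 + q + 1 by ring]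
    have e : mulX a ((if p + q + 1 = 0 then 1 else 0 : Module.End ℂ FullFock) t) =
        (if p + q + 1 = 0 then 1 else 0 : Module.End ℂ FullFock) (mulX a t) := by
      split_ifs <;> simp
    have e' : ∀ x : FullFock, (-Complex.I) • x = -(Complex.I • x) := 
      fun x => neg_smul (M := FullFock) _ x
    rw [e]
    simp only [e']
    abel
  · obtain ⟨M, h1, h2, hM⟩ := ((opC_opB_tmul_one p q v).and ((opB_opC_tmul_one p q v).and
      (Filter.eventually_ge_atTop (p.natAbs + q.natAbs + 2)))).exists
    rw [LinearMap.sub_apply, LinearMap.sub_apply, Module.End.mul_apply, Module.End.mul_apply, h1,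
      h2, ← Finset.sum_sub_distrib]
    simp only [← Finset.sum_sub_distrib, sub_neg_eq_add, ← TensorProduct.add_tmul,
      cMode_dbMode_apply]
    rw [Finset.sum_comm]
    -- Only k = -k' survives the anticommutator. Writing k' - q as (k' + 1) - (q + 1) shows the
    -- bosonic factor as a difference e(k' + 1) - e(k').
    have h3 : ∀ k' ∈ Finset.Icc (-M : ℤ) M, ∑ k ∈ Finset.Icc (-M : ℤ) M,
        (if k = -k' then (-k' : ℂ) • v else 0) ⊗ₜ[ℂ]
          (schur Complex.I (k - p - 1) * schur (-Complex.I) (k' - q) -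
            schur Complex.I (k - p) * schur (-Complex.I) (k' - q - 1)) =
        v ⊗ₜ[ℂ] ((-k' : ℂ) • (schur Complex.I (-(k' + 1) - p) *
          schur (-Complex.I) (k' + 1 - (q + 1)) -
            schur Complex.I (-k' - p) * schur (-Complex.I) (k' - (q + 1)))) := by
      intro k' hk'
      rw [Finset.sum_eq_single (-k'), if_pos rfl, TensorProduct.smul_tmul,
        show -k' - p - 1 = -(k' + 1) - p by ring, show k' - q = k' + 1 - (q + 1) by ring,
        show k' + 1 - (q + 1) - 1 = k' - (q + 1) by ring]
      · intro k _ hk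
        rw [if_neg hk, TensorProduct.zero_tmul]
      · intro h
        simp only [Finset.mem_Icc] at h hk'
        omega
    rw [Finset.sum_congr rfl h3, ← TensorProduct.tmul_sum,
      sum_Icc_neg_smul_sub (fun k : ℤ => schur Complex.I (-k - p) *
        schur (-Complex.I) (k - (q + 1))), sum_Icc_schur_mul_schur _ _ _ _ (by omega) (by omega),
      ← add_assoc]
    · split_ifs <;> simp
    · rw [schur_neg (-Complex.I) (by omega), mul_zero]
    · rw [schur_neg Complex.I (by omega), zero_mul]

/-! ### The current on the vacuum -/

theorem bMode_vac {k : ℤ} (hk : 1 ≤ k) : bMode k bcVac = 0 := by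
  rw [bMode, if_neg (by omega), bcAnnih, bcVac, CliffordAlgebra.contractLeft_one]

theorem cMode_vac {k : ℤ} (hk : 0 ≤ k) : cMode k bcVac = 0 := by
  rw [cMode, if_neg (by omega), bcAnnih, bcVac, CliffordAlgebra.contractLeft_one]

/-- The mode b(0) does not annihilate the vacuum; the factor k from the derivative removes it. -/
theorem dbMode_vac {k : ℤ} (hk : 0 ≤ k) : dbMode k bcVac = 0 := by
  rcases hk.eq_or_lt with rfl | hk
  · simp [dbMode]
  · rw [dbMode, LinearMap.smul_apply, bMode_vac (by omega), smul_zero]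

/-- For k < 0 the degree k - r of the bosonic factor is negative; for k ≥ 0 the fermion mode kills
the vacuum. -/
theorem opB_vac {r : ℤ} (hr : 0 ≤ r) : opB r (bcVac ⊗ₜ 1) = 0 := by
  obtain ⟨M, hM⟩ := (modeSum_tmul_one dbMode_isField (-Complex.I) r bcVac).exists
  rw [opB, hM]
  refine Finset.sum_eq_zero fun k _ => ?_
  rcases lt_or_ge k 0 with h | h
  · rw [schur_neg _ (by omega), TensorProduct.tmul_zero]
  · rw [dbMode_vac h, TensorProduct.zero_tmul]

theorem opC_vac {r : ℤ} (hr : 0 ≤ r) : opC r (bcVac ⊗ₜ 1) = 0 := by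
  obtain ⟨M, hM⟩ := (modeSum_tmul_one cMode_isField Complex.I r bcVac).exists
  rw [opC, hM]
  refine Finset.sum_eq_zero fun k _ => ?_
  rcases lt_or_ge k 0 with h | h
  · rw [schur_neg _ (by omega), TensorProduct.tmul_zero]
  · rw [cMode_vac h, TensorProduct.zero_tmul]

/-- The component of degree `-a-1` of the current `:γ(z) β(z):` acts on the vacuum as a multiple of
`j(-a-1)`. -/
theorem sum_opC_opB_vac (a : ℕ) :
    ∑ m ∈ Finset.range (a + 1), opC (-m) (opB (m - a - 1) (bcVac ⊗ₜ 1)) =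
      Complex.I • (bcVac ⊗ₜ MvPolynomial.X a) := by
  -- Taking p = -m - 1 in `opC_opB_tmul_one` makes the outer mode -m; the finitely many m share one
  -- window.
  have h : ∀ᶠ M : ℕ in Filter.atTop, ∀ m ∈ Finset.range (a + 1),
      opC (-m - 1 + 1) (opB (m - a - 1) (bcVac ⊗ₜ 1)) =
      ∑ k ∈ Finset.Icc (-M : ℤ) M, ∑ k' ∈ Finset.Icc (-M : ℤ) M, cMode k (dbMode k' bcVac) ⊗ₜ
        (schur Complex.I (k - (-m - 1) - 1) * schur (-Complex.I) (k' - (m - a - 1)) -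
          schur Complex.I (k - (-m - 1)) * schur (-Complex.I) (k' - (m - a - 1) - 1)) := by
    rw [Filter.eventually_all_finset]
    exact fun m _ => opC_opB_tmul_one (-m - 1) (m - a - 1) bcVac
  obtain ⟨M, hM, hMa⟩ := (h.and (Filter.eventually_ge_atTop (a + 1))).exists
  simp only [sub_add_cancel] at hM
  rw [Finset.sum_congr rfl hM, Finset.sum_comm]
  simp only [Finset.sum_comm (s := Finset.range (a + 1)), ← TensorProduct.tmul_sum]
  -- The two products in the bosonic factor differ by m ↦ m + 1, so the sum over m reduces to two
  -- end terms.
  have h1 : ∀ k k' : ℤ, ∑ m ∈ Finset.range (a + 1),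
      (schur Complex.I (k - (-m - 1) - 1) * schur (-Complex.I) (k' - (m - a - 1)) -
        schur Complex.I (k - (-m - 1)) * schur (-Complex.I) (k' - (m - a - 1) - 1)) =
      schur Complex.I k * schur (-Complex.I) (k' + a + 1) -
        schur Complex.I (k + a + 1) * schur (-Complex.I) k' := by
    intro k k'
    have := Finset.sum_range_sub' (fun m : ℕ =>
      schur Complex.I (k + m) * schur (-Complex.I) (k' + a + 1 - m)) (a + 1)
    rw [show k + ((0 : ℕ) : ℤ) = k by simp, show k' + a + 1 - ((0 : ℕ) : ℤ) = k' + a + 1 by simp,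
      show k + ((a + 1 : ℕ) : ℤ) = k + a + 1 by push_cast; ring,
      show k' + a + 1 - ((a + 1 : ℕ) : ℤ) = k' by push_cast; ring] at this
    rw [← this]
    refine Finset.sum_congr rfl fun m _ => ?_
    congr 3 <;> push_cast <;> ring
  -- For k' < 0 the second end term vanishes, and so does the first unless k ≥ 0. Then c(k) kills
  -- the vacuum and only the anticommutator at k = -k' is left. For k' ≥ 0 both sides are zero.
  have h2 : ∀ k' ∈ Finset.Icc (-M : ℤ) M, ∑ k ∈ Finset.Icc (-M : ℤ) M,
      cMode k (dbMode k' bcVac) ⊗ₜ[ℂ] ∑ m ∈ Finset.range (a + 1),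
      (schur Complex.I (k - (-m - 1) - 1) * schur (-Complex.I) (k' - (m - a - 1)) -
        schur Complex.I (k - (-m - 1)) * schur (-Complex.I) (k' - (m - a - 1) - 1)) =
      bcVac ⊗ₜ[ℂ] ((-k' : ℂ) • (schur Complex.I (-k') * schur (-Complex.I) (k' + a + 1))) := by
    intro k' hk'
    rcases lt_or_ge k' 0 with hneg | hpos
    · rw [Finset.sum_eq_single (-k')]
      · have h3 := cMode_dbMode_apply (-k') k' bcVac
        rw [cMode_vac (by omega), map_zero, add_zero, if_pos rfl] at h3
        rw [h3, h1, schur_neg (-Complex.I) hneg, mul_zero, sub_zero, TensorProduct.smul_tmul]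
      · intro k _ hk
        rw [h1, schur_neg (-Complex.I) hneg, mul_zero, sub_zero]
        rcases lt_or_ge k 0 with hk0 | hk0
        · rw [schur_neg _ hk0, zero_mul, TensorProduct.tmul_zero]
        · have h3 := cMode_dbMode_apply k k' bcVac
          rw [cMode_vac hk0, map_zero, add_zero, if_neg hk] at h3
          rw [h3, TensorProduct.zero_tmul]
      · intro h
        simp only [Finset.mem_Icc] at h hk'
        omega
    · rw [dbMode_vac hpos]
      simp only [map_zero, TensorProduct.zero_tmul, Finset.sum_const_zero]
      rcases hpos.eq_or_lt with rfl | hpos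
      · simp
      · rw [schur_neg Complex.I (by omega), zero_mul, smul_zero, TensorProduct.tmul_zero]
  -- What remains is, up to j = -k', the sum of j h_j(η) h_(a+1-j)(-η) with η² = -1: a coefficient
  -- of the logarithmic derivative of h_η.
  rw [Finset.sum_comm, Finset.sum_congr rfl h2, ← TensorProduct.tmul_sum,
    ← TensorProduct.tmul_smul, ← sum_mul_schur_mul_schur_neg]
  congr 1
  refine Finset.sum_bij_ne_zero (fun k _ _ => (-k).toNat) ?_ ?_ ?_ ?_
  · intro k hk h0
    have h1 : ¬ k + a + 1 < 0 := fun h1 => h0 (by rw [schur_neg (-Complex.I) h1, mul_zero, smul_zero])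
    have h2 : ¬ -k < 0 := fun h2 => h0 (by rw [schur_neg Complex.I h2, zero_mul, smul_zero])
    simp only [Finset.mem_range]
    omega
  · intro k hk h0 k' hk' h0' he
    have h2 : ¬ -k < 0 := fun h2 => h0 (by rw [schur_neg Complex.I h2, zero_mul, smul_zero])
    have h2' : ¬ -k' < 0 := fun h2 => h0' (by rw [schur_neg Complex.I h2, zero_mul, smul_zero])
    omega
  · intro i hi h0
    simp only [Finset.mem_range] at hi
    refine ⟨-i, ?_, ?_, ?_⟩
    · simp only [Finset.mem_Icc]
      omega
    · have e : -(i : ℤ) + a + 1 = a + 1 - i := by ring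
      rw [neg_neg, e]
      simpa using h0
    · omega
  · intro k hk h0
    have h2 : ¬ -k < 0 := fun h2 => h0 (by rw [schur_neg Complex.I h2, zero_mul, smul_zero])
    obtain ⟨n, hn⟩ := Int.eq_ofNat_of_zero_le (not_lt.mp h2)
    obtain rfl : k = -n := by omega
    have e : -(n : ℤ) + a + 1 = a + 1 - n := by ring
    rw [neg_neg, Int.toNat_natCast, e]
    simp

/-! ### The zero mode of `c` -/

/-- The operator `c(0)` acting on the first tensor factor. -/
def opC0 : Module.End ℂ FullFock := TensorProduct.map (cMode 0) LinearMap.id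

theorem opC0_modeSum {D : ℤ → Module.End ℂ BCFock} (hD : IsField D) (η : ℂ) (r : ℤ)
    (h : ∀ k v, cMode 0 (D k v) = -D k (cMode 0 v)) (t : FullFock) :
    opC0 (modeSum hD η r t) = -modeSum hD η r (opC0 t) := by
  obtain ⟨M, h1, h2⟩ := ((modeSum_eventually hD η r t).and
    (modeSum_eventually hD η r (opC0 t))).exists
  rw [h1, h2, map_sum, ← Finset.sum_neg_distrib]
  refine Finset.sum_congr rfl fun k _ => ?_
  clear h1 h2
  induction t using TensorProduct.induction_on with
  | zero => simp
  | tmul v w =>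
    simp only [opC0, TensorProduct.map_tmul, LinearMap.id_apply]
    rw [h, TensorProduct.neg_tmul]
  | add x y hx hy => simp only [map_add, hx, hy, neg_add]

/-- The anticommutator of c(0) with -k b(k) is -k δ_{k,0} = 0. With b in place of ∂b the mode b(0)
would obstruct. -/
theorem opC0_opB (r : ℤ) (t : FullFock) : opC0 (opB r t) = -opB r (opC0 t) :=
  opC0_modeSum _ _ _ (fun k v => by
    refine eq_neg_of_add_eq_zero_left ((cMode_dbMode_apply 0 k v).trans ?_)
    split_ifs with hk
    · obtain rfl : k = 0 := by omega
      simp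
    · rfl) t

theorem opC0_opC (r : ℤ) (t : FullFock) : opC0 (opC r t) = -opC r (opC0 t) :=
  opC0_modeSum _ _ _ (fun k v => cMode_cMode_apply 0 k v) t

theorem opC0_vac : opC0 (bcVac ⊗ₜ 1) = 0 := by
  rw [opC0, TensorProduct.map_tmul, cMode_vac le_rfl, TensorProduct.zero_tmul]

/-! ### The action on `N(s)` in terms of operators on the full tensor product -/

/-- The inclusion of the summand `F^l ⊗ H_{i(s+l)}` into `F ⊗ H`. -/
def embed (s : ℂ) (l : ℤ) : NComp s l →ₗ[ℂ] FullFock :=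
  TensorProduct.map (bcCharge l).subtype
    (LinearMap.id : HeisFock (Complex.I * (s + l)) →ₗ[ℂ] MvPolynomial ℕ ℂ)

theorem embed_tmul (s : ℂ) (l : ℤ) (v : bcCharge l) (w : HeisFock (Complex.I * (s + l))) :
    embed s l (v ⊗ₜ w) = (v : BCFock) ⊗ₜ (w : MvPolynomial ℕ ℂ) := rfl

theorem embed_injective (s : ℂ) (l : ℤ) : Function.Injective (embed s l) :=
  Module.Flat.rTensor_preserves_injective_linearMap (bcCharge l).subtype
    (Submodule.injective_subtype _)

/-- The families `(f_l)` of vectors of `F ⊗ H`. -/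
abbrev FullFamily : Type := ℤ → FullFock

/-- The inclusion of `N(s)` into the product of copies of `F ⊗ H`. -/
def toFull (s : ℂ) : N s →ₗ[ℂ] FullFamily :=
  DirectSum.toModule ℂ ℤ FullFamily fun l =>
    LinearMap.single ℂ (fun _ : ℤ => FullFock) l ∘ₗ embed s l

theorem toFull_lof (s : ℂ) (l : ℤ) (t : NComp s l) :
    toFull s (DirectSum.lof ℂ ℤ (NComp s) l t) = Pi.single l (embed s l t) := by
  rw [toFull, DirectSum.toModule_lof]
  rfl

theorem toFull_apply (s : ℂ) (x : N s) (l : ℤ) : toFull s x l = embed s l (x l) := by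
  have h : (LinearMap.proj l ∘ₗ toFull s : N s →ₗ[ℂ] FullFock) =
      embed s l ∘ₗ DirectSum.component ℂ ℤ (NComp s) l := by
    refine DirectSum.linearMap_ext ℂ fun j => LinearMap.ext fun t => ?_
    change toFull s (DirectSum.lof ℂ ℤ (NComp s) j t) l =
      embed s l (DirectSum.lof ℂ ℤ (NComp s) j t l)
    rw [toFull_lof]
    by_cases hj : j = l
    · subst hj
      rw [Pi.single_eq_same, DirectSum.lof_apply]
    · rw [Pi.single_eq_of_ne (Ne.symm hj), DirectSum.lof_eq_of,
        DirectSum.of_eq_of_ne _ _ _ (Ne.symm hj), map_zero]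
  exact LinearMap.congr_fun h x

/-- Identities in N(s) may therefore be tested on families in F ⊗ ℂ[x], where neither the weight
i(s+l) nor a charge such as l - 1 + 1 is part of a type. -/
theorem toFull_injective (s : ℂ) : Function.Injective (toFull s) := by
  intro x y h
  refine DFinsupp.ext fun l => embed_injective s l ?_
  have := congrFun h l
  rwa [toFull_apply, toFull_apply] at this

/-- The operator which corresponds to `β(n)`. -/
def fullB (n : ℤ) : FullFamily →ₗ[ℂ] FullFamily :=
  LinearMap.pi fun l => opB (n + l) ∘ₗ LinearMap.proj (l + 1)

/-- The operator which corresponds to `γ(n)`. -/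
def fullC (n : ℤ) : FullFamily →ₗ[ℂ] FullFamily :=
  LinearMap.pi fun l => opC (n - l + 1) ∘ₗ LinearMap.proj (l - 1)

theorem fullB_apply (n : ℤ) (f : FullFamily) (l : ℤ) : fullB n f l = opB (n + l) (f (l + 1)) := rfl

theorem fullC_apply (n : ℤ) (f : FullFamily) (l : ℤ) :
    fullC n f l = opC (n - l + 1) (f (l - 1)) := rfl

theorem fullB_single (n l : ℤ) (t : FullFock) :
    fullB n (Pi.single l t) = Pi.single (l - 1) (opB (n + l - 1) t) := by
  funext j
  rw [fullB_apply]
  by_cases h : j = l - 1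
  · subst h
    rw [sub_add_cancel, Pi.single_eq_same, Pi.single_eq_same, add_sub_assoc]
  · rw [Pi.single_eq_of_ne h, Pi.single_eq_of_ne (by omega), map_zero]

theorem fullC_single (n l : ℤ) (t : FullFock) :
    fullC n (Pi.single l t) = Pi.single (l + 1) (opC (n - l) t) := by
  funext j
  rw [fullC_apply]
  by_cases h : j = l + 1
  · subst h
    rw [add_sub_cancel_right, Pi.single_eq_same, Pi.single_eq_same]
    congr 2
    ring
  · rw [Pi.single_eq_of_ne h, Pi.single_eq_of_ne (by omega), map_zero]

theorem embed_betaTerm (s : ℂ) (l k m : ℤ) (t : NComp s l) :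
    embed s (l - 1) (betaTerm s l k m t) =
      TensorProduct.map (dbMode k) (vertexOp (-Complex.I) m) (embed s l t) := by
  induction t using TensorProduct.induction_on with
  | zero => simp only [map_zero]
  | add x y hx hy => simp only [map_add, hx, hy]
  | tmul v w =>
    rw [embed_tmul, TensorProduct.map_tmul, ← vertexMode_eq_vertexOp _ (Complex.I * (s + l))]
    rfl

theorem embed_gammaTerm (s : ℂ) (l k m : ℤ) (t : NComp s l) :
    embed s (l + 1) (gammaTerm s l k m t) =
      TensorProduct.map (cMode k) (vertexOp Complex.I m) (embed s l t) := by
  induction t using TensorProduct.induction_on with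
  | zero => simp only [map_zero]
  | add x y hx hy => simp only [map_add, hx, hy]
  | tmul v w =>
    rw [embed_tmul, TensorProduct.map_tmul, ← vertexMode_eq_vertexOp _ (Complex.I * (s + l))]
    rfl

/-- On the summand l the power z^(s+l) shifts modes, so β(n) becomes the component n + l - 1 of z
∂b(z) X_(-i)(z). -/
theorem toFull_betaN (s : ℂ) (n : ℤ) (x : N s) :
    toFull s (betaN s n x) = fullB n (toFull s x) := by
  have h : toFull s ∘ₗ betaN s n = fullB n ∘ₗ toFull s := by
    refine DirectSum.linearMap_ext ℂ fun l => LinearMap.ext fun t => ?_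
    change toFull s (betaN s n (DirectSum.lof ℂ ℤ (NComp s) l t)) =
      fullB n (toFull s (DirectSum.lof ℂ ℤ (NComp s) l t))
    rw [toFull_lof, fullB_single, betaN, DirectSum.toModule_lof, LinearMap.comp_apply, toFull_lof]
    congr 1
    rw [locFinSum_apply, opB, modeSum, locFinSum_apply]
    refine ((embed s (l - 1)).toAddMonoidHom.map_finsum (betaTerm_finite s l n t)).trans ?_
    refine finsum_congr fun k => (embed_betaTerm s l k _ t).trans ?_
    congr 3
    ring
  exact LinearMap.congr_fun h x

theorem toFull_gammaN (s : ℂ) (n : ℤ) (x : N s) :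
    toFull s (gammaN s n x) = fullC n (toFull s x) := by
  have h : toFull s ∘ₗ gammaN s n = fullC n ∘ₗ toFull s := by
    refine DirectSum.linearMap_ext ℂ fun l => LinearMap.ext fun t => ?_
    change toFull s (gammaN s n (DirectSum.lof ℂ ℤ (NComp s) l t)) =
      fullC n (toFull s (DirectSum.lof ℂ ℤ (NComp s) l t))
    rw [toFull_lof, fullC_single, gammaN, DirectSum.toModule_lof, LinearMap.comp_apply, toFull_lof]
    congr 1
    rw [locFinSum_apply, opC, modeSum, locFinSum_apply]
    refine ((embed s (l + 1)).toAddMonoidHom.map_finsum (gammaTerm_finite s l n t)).trans ?_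
    refine finsum_congr fun k => (embed_gammaTerm s l k _ t).trans ?_
    congr 3
    ring
  exact LinearMap.congr_fun h x

theorem embed_cZeroTerm (s : ℂ) (l : ℤ) (t : NComp s l) :
    embed (s - 1) (l + 1) (TensorProduct.map (cComp l 0)
      (LinearMap.id : HeisFock (Complex.I * (s + l)) →ₗ[ℂ]
        HeisFock (Complex.I * ((s - 1) + (l + 1 : ℤ)))) t) = opC0 (embed s l t) := by
  induction t using TensorProduct.induction_on with
  | zero => simp only [map_zero]
  | add x y hx hy => simp only [map_add, hx, hy]
  | tmul v w => rfl

theorem toFull_cZero (s : ℂ) (x : N s) (l : ℤ) :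
    toFull (s - 1) (cZero s x) l = opC0 (toFull s x (l - 1)) := by
  have h : (LinearMap.proj l ∘ₗ toFull (s - 1) ∘ₗ cZero s : N s →ₗ[ℂ] FullFock) =
      opC0 ∘ₗ LinearMap.proj (l - 1) ∘ₗ toFull s := by
    refine DirectSum.linearMap_ext ℂ fun j => LinearMap.ext fun t => ?_
    change toFull (s - 1) (cZero s (DirectSum.lof ℂ ℤ (NComp s) j t)) l =
      opC0 (toFull s (DirectSum.lof ℂ ℤ (NComp s) j t) (l - 1))
    rw [toFull_lof, cZero, DirectSum.toModule_lof, LinearMap.comp_apply, toFull_lof,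
      embed_cZeroTerm]
    by_cases hj : l = j + 1
    · subst hj
      rw [add_sub_cancel_right, Pi.single_eq_same, Pi.single_eq_same]
    · rw [Pi.single_eq_of_ne hj, Pi.single_eq_of_ne (by omega), map_zero]
  exact LinearMap.congr_fun h x

theorem mem_ker_cZero_iff (s : ℂ) (x : N s) :
    x ∈ LinearMap.ker (cZero s) ↔ ∀ l, opC0 (toFull s x l) = 0 := by
  rw [LinearMap.mem_ker, ← (toFull_injective (s - 1)).eq_iff, map_zero]
  constructor
  · intro h l
    have := congrFun h (l + 1)
    rwa [toFull_cZero, add_sub_cancel_right] at this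
  · intro h
    funext l
    rw [toFull_cZero, h]
    rfl

/-- The family which corresponds to the vacuum vector. -/
def fullVac : FullFamily := Pi.single 0 (bcVac ⊗ₜ[ℂ] (1 : MvPolynomial ℕ ℂ))

theorem toFull_NVac (s : ℂ) : toFull s (NVac s) = fullVac := by
  rw [NVac, toFull_lof, embed_tmul]
  rfl

/-! ### The commutation relations -/

theorem gammaN_betaN (s : ℂ) (m n : ℤ) :
    gammaN s m * betaN s n = betaN s n * gammaN s m + if m = -n then 1 else 0 := by
  refine LinearMap.ext fun x => toFull_injective s ?_
  rw [LinearMap.add_apply, Module.End.mul_apply, Module.End.mul_apply, map_add, toFull_gammaN,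
    toFull_betaN, toFull_betaN, toFull_gammaN]
  funext l
  -- The shifts by l cancel in the central term: (m - l) + (n + l - 1) + 1 = m + n.
  have h := LinearMap.congr_fun (opC_opB (m - l) (n + l - 1)) (toFull s x l)
  rw [LinearMap.add_apply, Module.End.mul_apply, Module.End.mul_apply, sub_add_cancel] at h
  rw [Pi.add_apply, fullC_apply, fullB_apply, fullB_apply, fullC_apply, sub_add_cancel,
    add_sub_cancel_right, show n + (l - 1) = n + l - 1 by ring,
    show m - (l + 1) + 1 = m - l by ring, h]
  congr 1
  by_cases hmn : m = -n
  · rw [if_pos hmn, if_pos (by omega), Module.End.one_apply, Module.End.one_apply]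
  · rw [if_neg hmn, if_neg (by omega), LinearMap.zero_apply, LinearMap.zero_apply, map_zero]
    rfl

theorem betaN_comm (s : ℂ) (m n : ℤ) : betaN s m * betaN s n = betaN s n * betaN s m := by
  refine LinearMap.ext fun x => toFull_injective s ?_
  rw [Module.End.mul_apply, Module.End.mul_apply, toFull_betaN, toFull_betaN, toFull_betaN,
    toFull_betaN]
  funext l
  have h := LinearMap.congr_fun (opB_comm (m + l) (n + l)) (toFull s x (l + 1 + 1))
  rw [Module.End.mul_apply, Module.End.mul_apply] at h
  rw [fullB_apply, fullB_apply, fullB_apply, fullB_apply, ← add_assoc, ← add_assoc, h]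

theorem gammaN_comm (s : ℂ) (m n : ℤ) : gammaN s m * gammaN s n = gammaN s n * gammaN s m := by
  refine LinearMap.ext fun x => toFull_injective s ?_
  rw [Module.End.mul_apply, Module.End.mul_apply, toFull_gammaN, toFull_gammaN, toFull_gammaN,
    toFull_gammaN]
  funext l
  have h := LinearMap.congr_fun (opC_comm (m - l + 1) (n - l + 1)) (toFull s x (l - 1 - 1))
  rw [Module.End.mul_apply, Module.End.mul_apply] at h
  rw [fullC_apply, fullC_apply, fullC_apply, fullC_apply,
    show n - (l - 1) + 1 = n - l + 1 + 1 by ring, show m - (l - 1) + 1 = m - l + 1 + 1 by ring, h]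

theorem betaN_vac (s : ℂ) {n : ℤ} (hn : 1 ≤ n) : betaN s n (NVac s) = 0 := by
  refine toFull_injective s ?_
  rw [toFull_betaN, toFull_NVac, fullVac, fullB_single, opB_vac (by omega), Pi.single_zero, map_zero]

theorem gammaN_vac (s : ℂ) {n : ℤ} (hn : 0 ≤ n) : gammaN s n (NVac s) = 0 := by
  refine toFull_injective s ?_
  rw [toFull_gammaN, toFull_NVac, fullVac, fullC_single, opC_vac (by omega), Pi.single_zero, map_zero]

/-! ### The `βγ` modes on polynomials -/

theorem betaMode_neg (k : ℕ) (v : BGFock) :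
    betaMode (-k) v = MvPolynomial.X (Sum.inl k) * v := by
  rw [betaMode, if_pos (by omega), neg_neg, Int.toNat_natCast, LinearMap.mulLeft_apply]

theorem gammaMode_neg (k : ℕ) (v : BGFock) :
    gammaMode (-k - 1) v = MvPolynomial.X (Sum.inr k) * v := by
  rw [gammaMode, if_pos (by omega), show -(-(k : ℤ) - 1) - 1 = k by ring, Int.toNat_natCast,
    LinearMap.mulLeft_apply]

theorem betaMode_succ (k : ℕ) (v : BGFock) :
    betaMode (k + 1) v = -MvPolynomial.pderiv (Sum.inr k) v := by
  rw [betaMode, if_neg (by omega), add_sub_cancel_right, Int.toNat_natCast]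
  rfl

theorem gammaMode_natCast (k : ℕ) (v : BGFock) :
    gammaMode k v = MvPolynomial.pderiv (Sum.inl k) v := by
  rw [gammaMode, if_neg (by omega), Int.toNat_natCast]
  rfl

theorem pderiv_X_mul (x y : ℕ ⊕ ℕ) (v : BGFock) :
    MvPolynomial.pderiv x (MvPolynomial.X y * v) =
      MvPolynomial.X y * MvPolynomial.pderiv x v + if x = y then v else 0 := by
  rw [Derivation.leibniz, MvPolynomial.pderiv_X, smul_eq_mul, smul_eq_mul]
  by_cases h : x = y
  · subst h
    rw [Pi.single_eq_same, mul_one, if_pos rfl]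
  · rw [Pi.single_eq_of_ne (Ne.symm h), mul_zero, if_neg h]

/-! ### The homomorphism `ε` -/

/-- The action of the creation operators `β(-k)`, `γ(-k-1)`, `k ≥ 0`, on `N(s)`. -/
def creationN (s : ℂ) : ℕ ⊕ ℕ → Module.End ℂ (N s) :=
  Sum.elim (fun k => betaN s (-k)) fun k => gammaN s (-k - 1)

theorem creationN_comm (s : ℂ) (x y : ℕ ⊕ ℕ) :
    creationN s x * creationN s y = creationN s y * creationN s x := by
  rcases x with k | k <;> rcases y with j | j
  · exact betaN_comm s _ _
  · refine (Eq.trans (gammaN_betaN s (-j - 1) (-k)) ?_).symm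
    rw [if_neg (by omega), add_zero]
    rfl
  · refine Eq.trans (gammaN_betaN s (-k - 1) (-j)) ?_
    rw [if_neg (by omega), add_zero]
    rfl
  · exact gammaN_comm s _ _

/-- The commutative algebra of operators generated by the creation operators. -/
instance creationAlgebraCommRing (s : ℂ) :
    CommRing (Algebra.adjoin ℂ (Set.range (creationN s))) :=
  { (inferInstance : Ring (Algebra.adjoin ℂ (Set.range (creationN s)))) with
    mul_comm := (Algebra.isMulCommutative_adjoin ℂ (by
      rintro _ ⟨x, rfl⟩ _ ⟨y, rfl⟩
      exact creationN_comm s x y)).is_comm.comm }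

/-- The action of polynomials in the creation operators on `N(s)`. -/
def creationHom (s : ℂ) : BGFock →ₐ[ℂ] Module.End ℂ (N s) :=
  (Algebra.adjoin ℂ (Set.range (creationN s))).val.comp
    (MvPolynomial.aeval (S₁ := Algebra.adjoin ℂ (Set.range (creationN s)))
      fun x => ⟨creationN s x, Algebra.subset_adjoin ⟨x, rfl⟩⟩)

theorem creationHom_X (s : ℂ) (x : ℕ ⊕ ℕ) :
    creationHom s (MvPolynomial.X x) = creationN s x := by
  rw [creationHom, AlgHom.comp_apply, MvPolynomial.aeval_X]
  rfl

/-- The homomorphism `M_s → N(s)`. -/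
def fmsHom (s : ℂ) : BGFock →ₗ[ℂ] N s :=
  LinearMap.applyₗ (NVac s) ∘ₗ (creationHom s).toLinearMap

theorem fmsHom_one (s : ℂ) : fmsHom s 1 = NVac s := by
  change creationHom s 1 (NVac s) = NVac s
  rw [map_one, Module.End.one_apply]

theorem fmsHom_C (s a : ℂ) : fmsHom s (MvPolynomial.C a) = a • NVac s := by
  rw [← mul_one (MvPolynomial.C a), ← MvPolynomial.smul_eq_C_mul, map_smul, fmsHom_one]

theorem fmsHom_X_mul (s : ℂ) (x : ℕ ⊕ ℕ) (v : BGFock) :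
    fmsHom s (MvPolynomial.X x * v) = creationN s x (fmsHom s v) := by
  change creationHom s (MvPolynomial.X x * v) (NVac s) = _
  rw [map_mul, creationHom_X, Module.End.mul_apply]
  rfl

/-- Creation modes are intertwined by construction. An annihilation mode kills both vacua and has
the same commutators with the creation modes on both sides, which allows induction on the
polynomial. -/
theorem fmsHom_beta (s : ℂ) (n : ℤ) (v : BGFock) :
    fmsHom s (betaMode n v) = betaN s n (fmsHom s v) := by
  rcases le_or_gt n 0 with hn | hn
  · obtain ⟨k, rfl⟩ : ∃ k : ℕ, n = -k := ⟨(-n).toNat, by omega⟩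
    rw [betaMode_neg, fmsHom_X_mul]
    rfl
  · obtain ⟨k, rfl⟩ : ∃ k : ℕ, n = k + 1 := ⟨(n - 1).toNat, by omega⟩
    induction v using MvPolynomial.induction_on with
    | C a =>
      rw [betaMode_succ, MvPolynomial.pderiv_C, neg_zero, map_zero, fmsHom_C, map_smul,
        betaN_vac s hn, smul_zero]
    | add v w hv hw => simp only [map_add, hv, hw]
    | mul_X v x hv =>
      rw [betaMode_succ] at hv ⊢
      rw [mul_comm, pderiv_X_mul, fmsHom_X_mul, neg_add, ← mul_neg, map_add, fmsHom_X_mul, hv]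
      rcases x with j | j
      · rw [if_neg (by simp), neg_zero, map_zero, add_zero]
        exact LinearMap.congr_fun (betaN_comm s (-j) (k + 1)) _
      · have h := LinearMap.congr_fun (gammaN_betaN s (-j - 1) (k + 1)) (fmsHom s v)
        rw [LinearMap.add_apply, Module.End.mul_apply, Module.End.mul_apply] at h
        change gammaN s (-j - 1) (betaN s (k + 1) (fmsHom s v)) + _ =
          betaN s (k + 1) (gammaN s (-j - 1) (fmsHom s v))
        rw [h]
        by_cases hj : k = j
        · subst hj
          rw [if_pos rfl, if_pos (by ring), Module.End.one_apply, map_neg, add_neg_cancel_right]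
        · rw [if_neg (by omega), if_neg (by simpa using hj), LinearMap.zero_apply, neg_zero,
            map_zero, add_zero, add_zero]

theorem fmsHom_gamma (s : ℂ) (n : ℤ) (v : BGFock) :
    fmsHom s (gammaMode n v) = gammaN s n (fmsHom s v) := by
  rcases lt_or_ge n 0 with hn | hn
  · obtain ⟨k, rfl⟩ : ∃ k : ℕ, n = -k - 1 := ⟨(-n - 1).toNat, by omega⟩
    rw [gammaMode_neg, fmsHom_X_mul]
    rfl
  · obtain ⟨k, rfl⟩ : ∃ k : ℕ, n = k := ⟨n.toNat, by omega⟩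
    induction v using MvPolynomial.induction_on with
    | C a =>
      rw [gammaMode_natCast, MvPolynomial.pderiv_C, map_zero, fmsHom_C, map_smul,
        gammaN_vac s hn, smul_zero]
    | add v w hv hw => simp only [map_add, hv, hw]
    | mul_X v x hv =>
      rw [gammaMode_natCast] at hv ⊢
      rw [mul_comm, pderiv_X_mul, fmsHom_X_mul, map_add, fmsHom_X_mul, hv]
      rcases x with j | j
      · have h := LinearMap.congr_fun (gammaN_betaN s k (-j)) (fmsHom s v)
        rw [LinearMap.add_apply, Module.End.mul_apply, Module.End.mul_apply] at h
        change betaN s (-j) (gammaN s k (fmsHom s v)) + _ =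
          gammaN s k (betaN s (-j) (fmsHom s v))
        rw [h]
        by_cases hj : k = j
        · subst hj
          rw [if_pos rfl, if_pos (by ring), Module.End.one_apply]
        · rw [if_neg (by simpa using hj), if_neg (by omega), LinearMap.zero_apply, map_zero]
      · rw [if_neg (by simp), map_zero, add_zero]
        exact LinearMap.congr_fun (gammaN_comm s (-j - 1) k) _

theorem fmsHom_isFMSHom (s : ℂ) : IsFMSHom s (fmsHom s) :=
  ⟨fmsHom_beta s, fmsHom_gamma s, fmsHom_one s⟩

theorem IsFMSHom.eq_fmsHom {s : ℂ} {ε : BGFock →ₗ[ℂ] N s} (h : IsFMSHom s ε) : ε = fmsHom s := by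
  refine LinearMap.ext fun v => ?_
  induction v using MvPolynomial.induction_on with
  | C a =>
    rw [fmsHom_C, ← mul_one (MvPolynomial.C a), ← MvPolynomial.smul_eq_C_mul, map_smul]
    exact congrArg _ h.map_vac
  | add v w hv hw => rw [map_add, map_add, hv, hw]
  | mul_X v x hv =>
    rw [mul_comm, fmsHom_X_mul, ← hv]
    rcases x with k | k
    · rw [← betaMode_neg, h.map_beta]
      rfl
    · rw [← gammaMode_neg, h.map_gamma]
      rfl

/-! ### Injectivity of `ε` -/

/-- A nonzero element of K of least degree would have zero derivatives, hence be a nonzero constant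
in characteristic zero, and K would contain 1. -/
theorem eq_bot_of_pderiv_mem {σ : Type} (K : Submodule ℂ (MvPolynomial σ ℂ))
    (hK : ∀ x, ∀ v ∈ K, MvPolynomial.pderiv x v ∈ K) (h1 : (1 : MvPolynomial σ ℂ) ∉ K) :
    K = ⊥ := by
  classical
  have key : ∀ (d : ℕ) (v : MvPolynomial σ ℂ), (∀ u ∈ v.support, u.degree < d) → v ∈ K → v = 0 := by
    intro d
    induction d with
    | zero =>
      intro v hv _
      refine MvPolynomial.support_eq_empty.mp (Finset.eq_empty_of_forall_notMem fun u hu => ?_)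
      exact absurd (hv u hu) (Nat.not_lt_zero _)
    | succ d ih =>
      intro v hv hvK
      have h0 : ∀ x, MvPolynomial.pderiv x v = 0 := by
        intro x
        refine ih _ (fun u hu => ?_) (hK x v hvK)
        rw [MvPolynomial.mem_support_iff, MvPolynomial.coeff_pderiv] at hu
        have := hv _ (MvPolynomial.mem_support_iff.mpr (left_ne_zero_of_mul hu))
        rw [map_add, Finsupp.degree_single] at this
        omega
      have hc : v = MvPolynomial.C (MvPolynomial.coeff 0 v) := by
        ext u
        rw [MvPolynomial.coeff_C]
        split_ifs with hu
        · rw [hu]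
        · obtain ⟨x, hx⟩ : ∃ x, u x ≠ 0 := by
            by_contra! hcon
            exact hu (Finsupp.ext fun x => (hcon x).symm)
          -- The coefficient of u reappears in the derivative along x, multiplied by the exponent u
          -- x ≠ 0.
          have h2 := congrArg (MvPolynomial.coeff (u - Finsupp.single x 1)) (h0 x)
          have h3 : u - Finsupp.single x 1 + Finsupp.single x 1 = u :=
            tsub_add_cancel_of_le (Finsupp.single_le_iff.mpr (by omega))
          rw [MvPolynomial.coeff_pderiv, h3, MvPolynomial.coeff_zero] at h2
          exact (mul_eq_zero.mp h2).resolve_right (Nat.cast_add_one_ne_zero _)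
      by_cases hz : MvPolynomial.coeff 0 v = 0
      · rw [hc, hz, map_zero]
      · refine absurd ?_ h1
        have := K.smul_mem (MvPolynomial.coeff 0 v)⁻¹ hvK
        rw [hc, MvPolynomial.coeff_C, if_pos rfl, MvPolynomial.smul_eq_C_mul,
          ← MvPolynomial.C_mul, inv_mul_cancel₀ hz, MvPolynomial.C_1] at this
        exact this
  refine (Submodule.eq_bot_iff K).mpr fun v hv =>
    key (v.support.sup (fun u => u.degree) + 1) v (fun u hu => ?_) hv
  exact Nat.lt_succ_of_le (Finset.le_sup (f := fun u : σ →₀ ℕ => u.degree) hu)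

/-- The augmentations of the two factors send this vector to 1. -/
theorem bcVac_tmul_one_ne_zero : (bcVac ⊗ₜ[ℂ] (1 : MvPolynomial ℕ ℂ) : FullFock) ≠ 0 := by
  intro h
  have h2 := congrArg (TensorProduct.lid ℂ ℂ ∘ TensorProduct.map
    (ExteriorAlgebra.algebraMapInv (R := ℂ) (M := (ℕ ⊕ ℕ) →₀ ℂ)).toLinearMap
    (MvPolynomial.aeval (R := ℂ) (fun _ : ℕ => (0 : ℂ))).toLinearMap) h
  simp [bcVac] at h2

theorem NVac_ne_zero (s : ℂ) : NVac s ≠ 0 := by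
  intro h
  have h2 := toFull_NVac s
  rw [h, map_zero] at h2
  have h3 := congrFun h2 0
  rw [fullVac, Pi.single_eq_same] at h3
  exact bcVac_tmul_one_ne_zero h3.symm

theorem fmsHom_injective (s : ℂ) : Function.Injective (fmsHom s) := by
  rw [← LinearMap.ker_eq_bot]
  refine eq_bot_of_pderiv_mem _ (fun x v hv => ?_) fun h => ?_
  · rw [LinearMap.mem_ker] at hv ⊢
    rcases x with k | k
    · rw [← gammaMode_natCast, fmsHom_gamma, hv, map_zero]
    · have := fmsHom_beta s (k + 1) v
      rwa [betaMode_succ, hv, map_zero, map_neg, neg_eq_zero] at this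
  · rw [LinearMap.mem_ker, fmsHom_one] at h
    exact NVac_ne_zero s h

/-- c(0) kills the vacuum and anticommutes with the operators that generate the image from it. -/
theorem range_fmsHom_le (s : ℂ) : LinearMap.range (fmsHom s) ≤ LinearMap.ker (cZero s) := by
  rintro _ ⟨v, rfl⟩
  rw [mem_ker_cZero_iff]
  induction v using MvPolynomial.induction_on with
  | C a =>
    intro l
    rw [fmsHom_C, map_smul, toFull_NVac, Pi.smul_apply, map_smul, fullVac]
    by_cases hl : l = 0
    · subst hl
      rw [Pi.single_eq_same, opC0_vac, smul_zero]
    · rw [Pi.single_eq_of_ne hl, map_zero, smul_zero]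
  | add v w hv hw =>
    intro l
    rw [map_add, map_add, Pi.add_apply, map_add, hv, hw, add_zero]
  | mul_X v x hv =>
    intro l
    rw [mul_comm, fmsHom_X_mul]
    rcases x with k | k
    · change opC0 (toFull s (betaN s (-k) (fmsHom s v)) l) = 0
      rw [toFull_betaN, fullB_apply, opC0_opB, hv, map_zero, neg_zero]
    · change opC0 (toFull s (gammaN s (-k - 1) (fmsHom s v)) l) = 0
      rw [toFull_gammaN, fullC_apply, opC0_opC, hv, map_zero, neg_zero]

/-! ### The kernel of `c(0)` on the `bc` Fock space -/

theorem bcAnnih_inl_zero : bcAnnih (Sum.inl 0) = cMode 0 := by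
  rw [cMode, if_neg (by omega), Int.toNat_zero]

/-- A subspace which contains the vacuum and is stable under all creation operators other than
`b(0)` contains the kernel of `c(0)`. -/
theorem mem_of_cMode_zero_eq_zero (W : Submodule ℂ BCFock) (h1 : bcVac ∈ W)
    (hW : ∀ x, x ≠ Sum.inl 0 → ∀ v ∈ W, bcCreate x v ∈ W) {v : BCFock} (hv : cMode 0 v = 0) :
    v ∈ W := by
  rw [← bcAnnih_inl_zero] at hv
  have hdc : ∀ x v, bcAnnih (Sum.inl 0) (bcCreate x v) + bcCreate x (bcAnnih (Sum.inl 0) v) =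
      if Sum.inl 0 = x then v else 0 := by
    intro x v
    have h := LinearMap.congr_fun (bcAnnih_create (Sum.inl 0) x) v
    rw [LinearMap.add_apply, Module.End.mul_apply, Module.End.mul_apply] at h
    rw [h]
    split_ifs <;> rfl
  have hcc : ∀ x y v, bcCreate x (bcCreate y v) = -bcCreate y (bcCreate x v) := fun x y v =>
    eq_neg_of_add_eq_zero_left (LinearMap.congr_fun (bcCreate_anticomm x y) v)
  set K : Submodule ℂ BCFock := W ⊓ LinearMap.ker (bcAnnih (Sum.inl 0))
  have hKc : ∀ x, x ≠ Sum.inl 0 → ∀ u ∈ K, bcCreate x u ∈ K := by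
    rintro x hx u ⟨hu1, hu2⟩
    refine ⟨hW x hx u hu1, ?_⟩
    have h := hdc x u
    rw [LinearMap.mem_ker.mp hu2, map_zero, add_zero, if_neg (Ne.symm hx)] at h
    exact h
  -- F = K + b(0) K: the sum contains the vacuum and is stable under every generator, since b(0)² =
  -- 0 and the others preserve K and anticommute with b(0).
  have key : ∀ w : BCFock, w ∈ K ⊔ K.map (bcCreate (Sum.inl 0)) := by
    have hR : ∀ x, ∀ w ∈ K ⊔ K.map (bcCreate (Sum.inl 0)),
        bcCreate x w ∈ K ⊔ K.map (bcCreate (Sum.inl 0)) := by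
      intro x w hw
      obtain ⟨u, hu, _, ⟨u', hu', rfl⟩, rfl⟩ := Submodule.mem_sup.mp hw
      rw [map_add]
      by_cases hx : x = Sum.inl 0
      · subst hx
        have h0 : bcCreate (Sum.inl 0) (bcCreate (Sum.inl 0) u') = 0 := by
          rw [bcCreate, LinearMap.mulLeft_apply, LinearMap.mulLeft_apply, ← mul_assoc,
            ExteriorAlgebra.ι_sq_zero, zero_mul]
        rw [h0, add_zero]
        exact Submodule.mem_sup_right ⟨u, hu, rfl⟩
      · rw [hcc x, ← map_neg]
        exact Submodule.add_mem _ (Submodule.mem_sup_left (hKc x hx u hu))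
          (Submodule.mem_sup_right ⟨_, Submodule.neg_mem _ (hKc x hx u' hu'), rfl⟩)
    intro w
    induction w using CliffordAlgebra.left_induction with
    | algebraMap r =>
      rw [Algebra.algebraMap_eq_smul_one]
      refine Submodule.smul_mem _ _ (Submodule.mem_sup_left ⟨h1, ?_⟩)
      exact LinearMap.mem_ker.mpr (bcAnnih_inl_zero ▸ cMode_vac le_rfl)
    | add w w' hw hw' => exact Submodule.add_mem _ hw hw'
    | ι_mul w a hw =>
      induction a using Finsupp.induction_linear with
      | zero => rw [map_zero, zero_mul]; exact Submodule.zero_mem _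
      | add a a' ha ha' => rw [map_add, add_mul]; exact Submodule.add_mem _ ha ha'
      | single x c =>
        rw [← Finsupp.smul_single_one, map_smul, smul_mul_assoc]
        exact Submodule.smul_mem _ _ (hR x w hw)
  -- For v = u + b(0) u' with u and u' in K one has c(0) v = u'. Hence u' = 0 and v = u.
  obtain ⟨u, hu, _, ⟨u', hu', rfl⟩, rfl⟩ := Submodule.mem_sup.mp (key v)
  have h := hdc (Sum.inl 0) u'
  rw [LinearMap.mem_ker.mp hu'.2, map_zero, add_zero, if_pos rfl] at h
  rw [map_add, LinearMap.mem_ker.mp hu.2, zero_add, h] at hv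
  rw [hv, map_zero, add_zero]
  exact hu.1

/-! ### Stability of the image under the creation operators of the boson -/

/-- The operator of multiplication by `x_a`. -/
def fullX (a : ℕ) : FullFamily →ₗ[ℂ] FullFamily :=
  LinearMap.pi fun l => mulX a ∘ₗ LinearMap.proj l

theorem fullX_apply (a : ℕ) (f : FullFamily) (l : ℤ) : fullX a f l = mulX a (f l) := rfl

theorem fullX_single (a : ℕ) (l : ℤ) (t : FullFock) :
    fullX a (Pi.single l t) = Pi.single l (mulX a t) := by
  funext j
  rw [fullX_apply]
  by_cases h : j = l
  · subst h
    rw [Pi.single_eq_same, Pi.single_eq_same]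
  · rw [Pi.single_eq_of_ne h, Pi.single_eq_of_ne h, map_zero]

theorem fullX_fullB (a : ℕ) (n : ℤ) (f : FullFamily) :
    fullX a (fullB n f) = fullB n (fullX a f) + (-Complex.I) • fullB (n - a - 1) f := by
  funext l
  rw [Pi.add_apply, Pi.smul_apply, fullX_apply, fullB_apply, fullB_apply, fullB_apply, fullX_apply,
    opB, mulX_modeSum, opB, show n + l - a - 1 = n - a - 1 + l by ring]

theorem fullX_fullC (a : ℕ) (n : ℤ) (f : FullFamily) :
    fullX a (fullC n f) = fullC n (fullX a f) + Complex.I • fullC (n - a - 1) f := by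
  funext l
  rw [Pi.add_apply, Pi.smul_apply, fullX_apply, fullC_apply, fullC_apply, fullC_apply, fullX_apply,
    opC, mulX_modeSum, opC, show n - l + 1 - a - 1 = n - a - 1 - l + 1 by ring]

/-- The image of `ε`. -/
def fmsImage (s : ℂ) : Submodule ℂ FullFamily := LinearMap.range (toFull s ∘ₗ fmsHom s)

theorem fullVac_mem (s : ℂ) : fullVac ∈ fmsImage s :=
  ⟨1, by rw [LinearMap.comp_apply, fmsHom_one, toFull_NVac]⟩

theorem fullB_mem (s : ℂ) (n : ℤ) {f : FullFamily} (hf : f ∈ fmsImage s) :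
    fullB n f ∈ fmsImage s := by
  obtain ⟨v, rfl⟩ := hf
  exact ⟨betaMode n v, by
    rw [LinearMap.comp_apply, LinearMap.comp_apply, fmsHom_beta, toFull_betaN]⟩

theorem fullC_mem (s : ℂ) (n : ℤ) {f : FullFamily} (hf : f ∈ fmsImage s) :
    fullC n f ∈ fmsImage s := by
  obtain ⟨v, rfl⟩ := hf
  exact ⟨gammaMode n v, by
    rw [LinearMap.comp_apply, LinearMap.comp_apply, fmsHom_gamma, toFull_gammaN]⟩

/-- By `sum_opC_opB_vac`, i x_a on the vacuum is a finite sum of products of γ and β modes, which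
preserve the image. -/
theorem fullX_vac_mem (s : ℂ) (a : ℕ) : fullX a fullVac ∈ fmsImage s := by
  have h : ∑ m ∈ Finset.range (a + 1), fullC (-m - 1) (fullB (m - a) fullVac) =
      Complex.I • fullX a fullVac := by
    rw [fullVac, fullX_single, mulX_tmul, mul_one, ← Pi.single_smul', ← sum_opC_opB_vac]
    refine Eq.trans ?_ (map_sum (LinearMap.single ℂ (fun _ : ℤ => FullFock) 0) _ _).symm
    refine Finset.sum_congr rfl fun m _ => ?_
    rw [fullB_single, fullC_single, LinearMap.single_apply, zero_sub, neg_add_cancel, add_zero,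
      sub_neg_eq_add, sub_add_cancel]
  rw [← inv_smul_smul₀ Complex.I_ne_zero (fullX a fullVac), ← h]
  exact Submodule.smul_mem _ _ (Submodule.sum_mem _ fun m _ =>
    fullC_mem s _ (fullB_mem s _ (fullVac_mem s)))

/-- Moving x_a past a mode costs only another mode of the same field, so the vacuum case propagates
to the whole image. -/
theorem fullX_mem (s : ℂ) (a : ℕ) {f : FullFamily} (hf : f ∈ fmsImage s) :
    fullX a f ∈ fmsImage s := by
  obtain ⟨v, rfl⟩ := hf
  induction v using MvPolynomial.induction_on with
  | C c =>
    rw [LinearMap.comp_apply, fmsHom_C, map_smul, map_smul, toFull_NVac]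
    exact Submodule.smul_mem _ _ (fullX_vac_mem s a)
  | add v w hv hw =>
    rw [map_add, map_add]
    exact Submodule.add_mem _ hv hw
  | mul_X v x hv =>
    have hv' : toFull s (fmsHom s v) ∈ fmsImage s := ⟨v, rfl⟩
    rw [mul_comm, LinearMap.comp_apply, fmsHom_X_mul]
    rcases x with k | k
    · change fullX a (toFull s (betaN s (-k) (fmsHom s v))) ∈ _
      rw [toFull_betaN, fullX_fullB]
      exact Submodule.add_mem _ (fullB_mem s _ hv) (Submodule.smul_mem _ _ (fullB_mem s _ hv'))
    · change fullX a (toFull s (gammaN s (-k - 1) (fmsHom s v))) ∈ _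
      rw [toFull_gammaN, fullX_fullC]
      exact Submodule.add_mem _ (fullC_mem s _ hv) (Submodule.smul_mem _ _ (fullC_mem s _ hv'))

theorem tmul_mem_of_mulX_mem (P : Submodule ℂ FullFock) (hX : ∀ a, ∀ t ∈ P, mulX a t ∈ P)
    {v : BCFock} (hv : v ⊗ₜ 1 ∈ P) (w : MvPolynomial ℕ ℂ) : v ⊗ₜ w ∈ P := by
  induction w using MvPolynomial.induction_on with
  | C a =>
    rw [← mul_one (MvPolynomial.C a), ← MvPolynomial.smul_eq_C_mul, TensorProduct.tmul_smul]
    exact P.smul_mem _ hv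
  | add w w' hw hw' =>
    rw [TensorProduct.tmul_add]
    exact P.add_mem hw hw'
  | mul_X w n hw =>
    rw [mul_comm]
    exact hX n _ hw

/-- On v ⊗ 1 the component of degree k is D(k) v ⊗ 1 plus terms D(j) v ⊗ h_(j-k) with j > k. This
triangular system is solved by descending induction, starting above d, where all modes vanish on v.
-/
theorem mode_tmul_one_mem {D : ℤ → Module.End ℂ BCFock} (hD : IsField D) (η : ℂ)
    (P : Submodule ℂ FullFock) (hX : ∀ a, ∀ t ∈ P, mulX a t ∈ P) {v : BCFock}
    (hP : ∀ r, modeSum hD η r (v ⊗ₜ 1) ∈ P) (k : ℤ) : D k v ⊗ₜ 1 ∈ P := by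
  obtain ⟨d, hd⟩ := hD v
  have key : ∀ (n : ℕ) (k : ℤ), d - n < k → D k v ⊗ₜ 1 ∈ P := by
    intro n
    induction n with
    | zero =>
      intro k hk
      rw [hd k (by omega), TensorProduct.zero_tmul]
      exact P.zero_mem
    | succ n ih =>
      intro k hk
      obtain ⟨M, hM, hMk⟩ := ((modeSum_tmul_one hD η k v).and
        (Filter.eventually_ge_atTop k.natAbs)).exists
      have hmem : k ∈ Finset.Icc (-M : ℤ) M := by
        rw [Finset.mem_Icc]
        omega
      have h := hP k
      rw [hM, ← Finset.add_sum_erase _ _ hmem, sub_self, schur_zero] at h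
      refine (Submodule.add_mem_iff_left P (Submodule.sum_mem _ fun j hj => ?_)).mp h
      rw [Finset.mem_erase] at hj
      rcases lt_or_gt_of_ne hj.1 with hlt | hgt
      · rw [schur_neg _ (by omega), TensorProduct.tmul_zero]
        exact P.zero_mem
      · exact tmul_mem_of_mulX_mem P hX (ih j (by push_cast at hk; omega)) _
  exact key (d - k + 1).toNat k (by omega)

/-! ### The image of `ε` -/

/-- The component of degree `l` of the image of `ε`. -/
def imageComp (s : ℂ) (l : ℤ) : Submodule ℂ FullFock :=
  (fmsImage s).comap (LinearMap.single ℂ (fun _ : ℤ => FullFock) l)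

theorem mem_imageComp (s : ℂ) (l : ℤ) (t : FullFock) :
    t ∈ imageComp s l ↔ (Pi.single l t : FullFamily) ∈ fmsImage s := Iff.rfl

theorem mulX_mem_imageComp (s : ℂ) (l : ℤ) (a : ℕ) (t : FullFock) (ht : t ∈ imageComp s l) :
    mulX a t ∈ imageComp s l := by
  rw [mem_imageComp] at ht ⊢
  rw [← fullX_single]
  exact fullX_mem s a ht

theorem dbMode_mem_imageComp (s : ℂ) (l k : ℤ) {v : BCFock} (hv : v ⊗ₜ 1 ∈ imageComp s l) :
    dbMode k v ⊗ₜ 1 ∈ imageComp s (l - 1) := by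
  refine mode_tmul_one_mem dbMode_isField (-Complex.I) _ (mulX_mem_imageComp s _) (fun r => ?_) k
  rw [mem_imageComp] at hv ⊢
  have h := fullB_mem s (r - l + 1) hv
  rwa [fullB_single, show r - l + 1 + l - 1 = r by ring] at h

theorem cMode_mem_imageComp (s : ℂ) (l k : ℤ) {v : BCFock} (hv : v ⊗ₜ 1 ∈ imageComp s l) :
    cMode k v ⊗ₜ 1 ∈ imageComp s (l + 1) := by
  refine mode_tmul_one_mem cMode_isField Complex.I _ (mulX_mem_imageComp s _) (fun r => ?_) k
  rw [mem_imageComp] at hv ⊢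
  have h := fullC_mem s (r + l) hv
  rwa [fullC_single, add_sub_cancel_right] at h

/-- The vectors `v` of charge `l` such that `v ⊗ 1` lies in the image of `ε`. -/
def imageCharge (s : ℂ) (l : ℤ) : Submodule ℂ BCFock :=
  bcCharge l ⊓ (imageComp s l).comap ((TensorProduct.mk ℂ BCFock (MvPolynomial ℕ ℂ)).flip 1)

/-- The field ∂b supplies only k b(-k), so b(0) cannot be reached; for k ≠ 0 the factor is divided
out. -/
theorem bcCreate_mem_imageCharge (s : ℂ) (l : ℤ) {x : ℕ ⊕ ℕ} (hx : x ≠ Sum.inl 0) {v : BCFock}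
    (hv : v ∈ imageCharge s l) : ∃ l', bcCreate x v ∈ imageCharge s l' := by
  obtain ⟨h1, h2⟩ := hv
  rcases x with k | k
  · have hk : (k : ℂ) ≠ 0 := Nat.cast_ne_zero.mpr fun h => hx (by rw [h])
    have e : bcCreate (Sum.inl k) = bMode (-k) := by
      rw [bMode, if_pos (by omega), neg_neg, Int.toNat_natCast]
    refine ⟨l - 1, ?_, ?_⟩
    · rw [e]
      exact bMode_mem _ h1
    · have h := dbMode_mem_imageComp s l (-k) h2
      rw [dbMode, ← e, LinearMap.smul_apply, Int.cast_neg, neg_neg, Int.cast_natCast,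
        ← TensorProduct.smul_tmul'] at h
      exact (Submodule.smul_mem_iff _ hk).mp h
  · have e : bcCreate (Sum.inr k) = cMode (-k - 1) := by
      rw [cMode, if_pos (by omega), show -(-(k : ℤ) - 1) - 1 = k by ring, Int.toNat_natCast]
    rw [e]
    exact ⟨l + 1, cMode_mem _ h1, cMode_mem_imageComp s l _ h2⟩

theorem bcCharge_iSupIndep : iSupIndep bcCharge :=
  (Module.End.eigenspaces_iSupIndep bcCurrentZero).comp Int.cast_injective

/-- Generation by creation operators only places a vector in the sum of the W l; independence of the
E l recovers the component of the right charge. -/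
theorem mem_of_mem_iSup_of_le {E W : ℤ → Submodule ℂ BCFock} (hE : iSupIndep E)
    (hW : ∀ l, W l ≤ E l) {l : ℤ} {v : BCFock} (hv : v ∈ E l) (hvW : v ∈ ⨆ j, W j) :
    v ∈ W l := by
  have h1 : ⨆ j, W j ≤ W l ⊔ ⨆ j, ⨆ _ : j ≠ l, E j := by
    refine iSup_le fun j => ?_
    by_cases hj : j = l
    · subst hj
      exact le_sup_left
    · exact (hW j).trans (le_sup_of_le_right (le_iSup₂_of_le j hj le_rfl))
  obtain ⟨w, hw, u, hu, rfl⟩ := Submodule.mem_sup.mp (h1 hvW)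
  have hu' : u ∈ E l := (Submodule.add_mem_iff_right _ (hW l hw)).mp hv
  have : u = 0 := Submodule.disjoint_def.mp (hE l) u hu' hu
  rwa [this, add_zero]

theorem mem_imageCharge_of_cMode_zero (s : ℂ) (l : ℤ) {v : BCFock} (hv : v ∈ bcCharge l)
    (h0 : cMode 0 v = 0) : v ∈ imageCharge s l := by
  refine mem_of_mem_iSup_of_le (W := imageCharge s) bcCharge_iSupIndep (fun j => inf_le_left) hv ?_
  refine mem_of_cMode_zero_eq_zero _ ?_ (fun x hx w hw => ?_) h0
  · exact Submodule.mem_iSup_of_mem 0 ⟨bcVac_mem, fullVac_mem s⟩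
  · induction hw using Submodule.iSup_induction' with
    | mem j w hw =>
      obtain ⟨l', h⟩ := bcCreate_mem_imageCharge s j hx hw
      exact Submodule.mem_iSup_of_mem l' h
    | zero => rw [map_zero]; exact Submodule.zero_mem _
    | add w w' _ _ hw hw' => rw [map_add]; exact Submodule.add_mem _ hw hw'

/-- The inclusion of `\bar F^l ⊗ H_{i(s+l)}` into `F^l ⊗ H_{i(s+l)}`. -/
def barInclusion (s : ℂ) (l : ℤ) :
    barF l ⊗[ℂ] HeisFock (Complex.I * (s + l)) →ₗ[ℂ] NComp s l :=
  TensorProduct.map (barF l).subtype LinearMap.id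

theorem barInclusion_injective (s : ℂ) (l : ℤ) : Function.Injective (barInclusion s l) :=
  Module.Flat.rTensor_preserves_injective_linearMap (barF l).subtype
    (Submodule.injective_subtype _)

theorem embed_barInclusion_mem (s : ℂ) (l : ℤ)
    (y : barF l ⊗[ℂ] HeisFock (Complex.I * (s + l))) :
    embed s l (barInclusion s l y) ∈ imageComp s l := by
  induction y using TensorProduct.induction_on with
  | zero => rw [map_zero, map_zero]; exact Submodule.zero_mem _
  | add y y' hy hy' => rw [map_add, map_add]; exact Submodule.add_mem _ hy hy'
  | tmul v w =>
    refine tmul_mem_of_mulX_mem _ (mulX_mem_imageComp s l) (v := ((v : bcCharge l) : BCFock)) ?_ w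
    exact (mem_imageCharge_of_cMode_zero s l v.1.2 (congrArg Subtype.val v.2)).2

/-- Vector spaces are flat, so tensoring keeps ker f → V → V' exact. -/
theorem mem_range_map_ker_subtype {V V' M : Type} [AddCommGroup V] [Module ℂ V] [AddCommGroup V']
    [Module ℂ V'] [AddCommGroup M] [Module ℂ M] (f : V →ₗ[ℂ] V') {t : V ⊗[ℂ] M}
    (ht : TensorProduct.map f LinearMap.id t = 0) :
    t ∈ LinearMap.range (TensorProduct.map (LinearMap.ker f).subtype (LinearMap.id : M →ₗ[ℂ] M)) :=
  (Module.Flat.rTensor_exact M (LinearMap.exact_subtype_ker_map f) t).mp ht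

theorem mem_range_barInclusion (s : ℂ) (l : ℤ) {t : NComp s l} (ht : opC0 (embed s l t) = 0) :
    t ∈ LinearMap.range (barInclusion s l) := by
  rw [← embed_cZeroTerm] at ht
  exact mem_range_map_ker_subtype (cComp l 0)
    (embed_injective (s - 1) (l + 1) (ht.trans (map_zero _).symm))

theorem opC0_embed_barInclusion (s : ℂ) (l : ℤ)
    (y : barF l ⊗[ℂ] HeisFock (Complex.I * (s + l))) :
    opC0 (embed s l (barInclusion s l y)) = 0 := by
  induction y using TensorProduct.induction_on with
  | zero => simp only [map_zero]
  | add y y' hy hy' => rw [map_add, map_add, map_add, hy, hy', add_zero]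
  | tmul v w =>
    have h : cMode 0 ((v : bcCharge l) : BCFock) = 0 := congrArg Subtype.val v.2
    change cMode 0 ((v : bcCharge l) : BCFock) ⊗ₜ[ℂ] (w : MvPolynomial ℕ ℂ) = 0
    rw [h, TensorProduct.zero_tmul]

/-- c(0) acts on each summand separately, so every component of a kernel vector comes from \bar F^l
⊗ H and hence lies in the image. -/
theorem range_fmsHom (s : ℂ) : LinearMap.range (fmsHom s) = LinearMap.ker (cZero s) := by
  classical
  refine le_antisymm (range_fmsHom_le s) fun x hx => ?_
  rw [mem_ker_cZero_iff] at hx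
  have h : toFull s x ∈ fmsImage s := by
    rw [← DirectSum.sum_support_of x, map_sum]
    refine Submodule.sum_mem _ fun l _ => ?_
    rw [← DirectSum.lof_eq_of ℂ, toFull_lof, ← mem_imageComp]
    have hl := hx l
    rw [toFull_apply] at hl
    obtain ⟨y, hy⟩ := mem_range_barInclusion s l hl
    rw [← hy]
    exact embed_barInclusion_mem s l y
  obtain ⟨v, hv⟩ := h
  exact ⟨v, toFull_injective s hv⟩

/-! ### Charges -/

theorem bgNormal_of_pos (k : ℕ) (v : BGFock) : bgNormal (k + 1) v =
    -(MvPolynomial.X (Sum.inr k) * MvPolynomial.pderiv (Sum.inr k) v) := by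
  rw [bgNormal, if_pos (by omega), Module.End.mul_apply, betaMode_succ, map_neg,
    show -((k : ℤ) + 1) = -k - 1 by ring, gammaMode_neg]

theorem bgNormal_of_nonpos (k : ℕ) (v : BGFock) : bgNormal (-k) v =
    MvPolynomial.X (Sum.inl k) * MvPolynomial.pderiv (Sum.inl k) v := by
  rw [bgNormal, if_neg (by omega), Module.End.mul_apply, neg_neg, gammaMode_natCast, betaMode_neg]

theorem bgNormal_X_inl_mul (k : ℤ) (j : ℕ) (v : BGFock) :
    bgNormal k (MvPolynomial.X (Sum.inl j) * v) = MvPolynomial.X (Sum.inl j) * bgNormal k v +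
      if k = -j then MvPolynomial.X (Sum.inl j) * v else 0 := by
  rcases le_or_gt k 0 with hk | hk
  · obtain ⟨k, rfl⟩ : ∃ m : ℕ, k = -m := ⟨(-k).toNat, by omega⟩
    rw [bgNormal_of_nonpos, bgNormal_of_nonpos, pderiv_X_mul, mul_add, mul_left_comm]
    congr 1
    by_cases h : k = j
    · subst h; rw [if_pos rfl, if_pos rfl]
    · rw [if_neg (by simpa using h), if_neg (by omega), mul_zero]
  · obtain ⟨k, rfl⟩ : ∃ m : ℕ, k = m + 1 := ⟨(k - 1).toNat, by omega⟩
    rw [bgNormal_of_pos, bgNormal_of_pos, pderiv_X_mul, if_neg (by simp), if_neg (by omega),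
      add_zero, add_zero, mul_left_comm, mul_neg]

theorem bgNormal_X_inr_mul (k : ℤ) (j : ℕ) (v : BGFock) :
    bgNormal k (MvPolynomial.X (Sum.inr j) * v) = MvPolynomial.X (Sum.inr j) * bgNormal k v -
      if k = j + 1 then MvPolynomial.X (Sum.inr j) * v else 0 := by
  rcases le_or_gt k 0 with hk | hk
  · obtain ⟨k, rfl⟩ : ∃ m : ℕ, k = -m := ⟨(-k).toNat, by omega⟩
    rw [bgNormal_of_nonpos, bgNormal_of_nonpos, pderiv_X_mul, if_neg (by simp), if_neg (by omega),
      add_zero, sub_zero, mul_left_comm]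
  · obtain ⟨k, rfl⟩ : ∃ m : ℕ, k = m + 1 := ⟨(k - 1).toNat, by omega⟩
    rw [bgNormal_of_pos, bgNormal_of_pos, pderiv_X_mul, mul_add, mul_left_comm, neg_add, mul_neg,
      sub_eq_add_neg]
    congr 2
    by_cases h : k = j
    · subst h; rw [if_pos rfl, if_pos rfl]
    · rw [if_neg (by simpa using h), if_neg (by omega), mul_zero]

theorem mul_bgCurrentZero (x : ℕ ⊕ ℕ) (v : BGFock) :
    (Function.support fun k => MvPolynomial.X x * bgNormal k v).Finite ∧
      MvPolynomial.X x * bgCurrentZero v = ∑ᶠ k, MvPolynomial.X x * bgNormal k v := by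
  refine ⟨(bgNormal_finite v).subset fun k hk h0 => hk (by simp only [h0, mul_zero]), ?_⟩
  rw [bgCurrentZero, locFinSum_apply]
  exact (AddMonoidHom.mulLeft (MvPolynomial.X x : BGFock)).map_finsum (bgNormal_finite v)

theorem bgCurrentZero_X_inl_mul (j : ℕ) (v : BGFock) :
    bgCurrentZero (MvPolynomial.X (Sum.inl j) * v) =
      MvPolynomial.X (Sum.inl j) * bgCurrentZero v + MvPolynomial.X (Sum.inl j) * v := by
  obtain ⟨h1, h2⟩ := mul_bgCurrentZero (Sum.inl j) v
  obtain ⟨h3, h4⟩ := finsum_single (-j) (MvPolynomial.X (Sum.inl j) * v : BGFock)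
  rw [h2, bgCurrentZero, locFinSum_apply, finsum_congr fun k => bgNormal_X_inl_mul k j v,
    finsum_add_distrib h1 h3, h4]

theorem bgCurrentZero_X_inr_mul (j : ℕ) (v : BGFock) :
    bgCurrentZero (MvPolynomial.X (Sum.inr j) * v) =
      MvPolynomial.X (Sum.inr j) * bgCurrentZero v - MvPolynomial.X (Sum.inr j) * v := by
  obtain ⟨h1, h2⟩ := mul_bgCurrentZero (Sum.inr j) v
  obtain ⟨h3, h4⟩ := finsum_single (j + 1) (MvPolynomial.X (Sum.inr j) * v : BGFock)
  rw [h2, bgCurrentZero, locFinSum_apply, finsum_congr fun k => bgNormal_X_inr_mul k j v,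
    finsum_sub_distrib h1 h3, h4]

theorem bgCurrentZero_C (a : ℂ) : bgCurrentZero (MvPolynomial.C a) = 0 := by
  rw [bgCurrentZero, locFinSum_apply]
  refine finsum_eq_zero_of_forall_eq_zero fun k => ?_
  rcases le_or_gt k 0 with hk | hk
  · obtain ⟨k, rfl⟩ : ∃ m : ℕ, k = -m := ⟨(-k).toNat, by omega⟩
    rw [bgNormal_of_nonpos, MvPolynomial.pderiv_C, mul_zero]
  · obtain ⟨k, rfl⟩ : ∃ m : ℕ, k = m + 1 := ⟨(k - 1).toNat, by omega⟩
    rw [bgNormal_of_pos, MvPolynomial.pderiv_C, mul_zero, neg_zero]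

/-- A creation mode of β raises the eigenvalue of the current by one and lowers l by one, and γ does
the opposite; on the vacuum both vanish. -/
theorem toFull_fmsHom_bgCurrentZero (s : ℂ) (v : BGFock) (l : ℤ) :
    toFull s (fmsHom s (bgCurrentZero v)) l = (-l : ℂ) • toFull s (fmsHom s v) l := by
  induction v using MvPolynomial.induction_on generalizing l with
  | C a =>
    rw [bgCurrentZero_C, map_zero, map_zero, fmsHom_C, map_smul, toFull_NVac, Pi.smul_apply,
      fullVac]
    by_cases hl : l = 0
    · subst hl
      simp
    · rw [Pi.single_eq_of_ne hl, smul_zero, smul_zero]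
      rfl
  | add v w hv hw => simp only [map_add, Pi.add_apply, hv, hw, smul_add]
  | mul_X v x hv =>
    rw [mul_comm]
    rcases x with j | j
    · rw [bgCurrentZero_X_inl_mul, map_add, fmsHom_X_mul, fmsHom_X_mul, map_add, Pi.add_apply]
      change toFull s (betaN s (-j) _) l + toFull s (betaN s (-j) _) l =
        (-l : ℂ) • toFull s (betaN s (-j) _) l
      rw [toFull_betaN, toFull_betaN, fullB_apply, fullB_apply, hv, map_smul]
      push_cast
      module
    · rw [bgCurrentZero_X_inr_mul, map_sub, fmsHom_X_mul, fmsHom_X_mul, map_sub, Pi.sub_apply]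
      change toFull s (gammaN s (-j - 1) _) l - toFull s (gammaN s (-j - 1) _) l =
        (-l : ℂ) • toFull s (gammaN s (-j - 1) _) l
      rw [toFull_gammaN, toFull_gammaN, fullC_apply, fullC_apply, hv, map_smul]
      push_cast
      module

/-- Since ε is injective, the eigenvalue equation can be read on components, where it becomes (j -
l) f_j = 0. -/
theorem mem_bgCharge_iff (s : ℂ) (l : ℤ) (v : BGFock) :
    v ∈ bgCharge l ↔ ∀ j, j ≠ l → toFull s (fmsHom s v) j = 0 := by
  rw [bgCharge, Module.End.mem_eigenspace_iff,
    ← ((toFull_injective s).comp (fmsHom_injective s)).eq_iff, funext_iff]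
  simp only [Function.comp_apply, LinearMap.neg_apply, map_neg, map_smul, Pi.neg_apply,
    Pi.smul_apply, toFull_fmsHom_bgCurrentZero]
  refine forall_congr' fun j => ?_
  have e : -((-j : ℂ) • toFull s (fmsHom s v) j) = (j : ℂ) • toFull s (fmsHom s v) j := by module
  rw [e]
  constructor
  · intro h hj
    have h' : ((j : ℂ) - l) • toFull s (fmsHom s v) j = 0 :=
      (sub_smul (M := FullFock) _ _ _).trans (sub_eq_zero.mpr h)
    exact (smul_eq_zero.mp h').resolve_left (sub_ne_zero.mpr (by exact_mod_cast hj))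
  · intro h
    by_cases hj : j = l
    · rw [hj]
    · rw [h hj, smul_zero, smul_zero]

/-- The inclusion of `\bar F^l ⊗ H_{i(s+l)}` into `N(s)`. -/
def barToN (s : ℂ) (l : ℤ) : barF l ⊗[ℂ] HeisFock (Complex.I * (s + l)) →ₗ[ℂ] N s :=
  DirectSum.lof ℂ ℤ (NComp s) l ∘ₗ barInclusion s l

theorem barToN_injective (s : ℂ) (l : ℤ) : Function.Injective (barToN s l) :=
  (DirectSum.of_injective (β := NComp s) l).comp (barInclusion_injective s l)

/-- The restriction of `ε` to the subspace of charge `l`. -/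
def fmsHomCharge (s : ℂ) (l : ℤ) : bgCharge l →ₗ[ℂ] N s := fmsHom s ∘ₗ (bgCharge l).subtype

theorem fmsHomCharge_injective (s : ℂ) (l : ℤ) : Function.Injective (fmsHomCharge s l) :=
  (fmsHom_injective s).comp (Submodule.injective_subtype _)

/-- Vectors of charge l are those whose image sits in the summand l, so both sides are the part of
ker c(0) in that summand. -/
theorem range_fmsHomCharge (s : ℂ) (l : ℤ) :
    LinearMap.range (fmsHomCharge s l) = LinearMap.range (barToN s l) := by
  refine le_antisymm ?_ ?_
  · rintro _ ⟨v, rfl⟩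
    have hv := (mem_bgCharge_iff s l v).mp v.2
    have hk := (mem_ker_cZero_iff s _).mp (range_fmsHom_le s ⟨(v : BGFock), rfl⟩) l
    rw [toFull_apply] at hk
    obtain ⟨y, hy⟩ := mem_range_barInclusion s l hk
    refine ⟨y, toFull_injective s ?_⟩
    rw [barToN, LinearMap.comp_apply, hy, toFull_lof, ← toFull_apply]
    funext j
    by_cases hj : j = l
    · subst hj
      rw [Pi.single_eq_same]
      rfl
    · rw [Pi.single_eq_of_ne hj]
      exact (hv j hj).symm
  · rintro _ ⟨y, rfl⟩
    have hmem : barToN s l y ∈ LinearMap.range (fmsHom s) := by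
      rw [range_fmsHom, mem_ker_cZero_iff]
      intro j
      rw [barToN, LinearMap.comp_apply, toFull_lof]
      by_cases hj : j = l
      · subst hj
        rw [Pi.single_eq_same, opC0_embed_barInclusion]
      · rw [Pi.single_eq_of_ne hj, map_zero]
    obtain ⟨v, hv⟩ := hmem
    refine ⟨⟨v, (mem_bgCharge_iff s l v).mpr fun j hj => ?_⟩, hv⟩
    rw [hv, barToN, LinearMap.comp_apply, toFull_lof, Pi.single_eq_of_ne hj]

/-- The isomorphism of the subspace of charge `l` with `\bar F^l ⊗ H_{i(s+l)}`. -/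
def chargeEquiv (s : ℂ) (l : ℤ) :
    bgCharge l ≃ₗ[ℂ] barF l ⊗[ℂ] HeisFock (Complex.I * (s + l)) :=
  (LinearEquiv.ofInjective (fmsHomCharge s l) (fmsHomCharge_injective s l)).trans
    ((LinearEquiv.ofEq _ _ (range_fmsHomCharge s l)).trans
      (LinearEquiv.ofInjective (barToN s l) (barToN_injective s l)).symm)

theorem barToN_chargeEquiv (s : ℂ) (l : ℤ) (v : bgCharge l) :
    barToN s l (chargeEquiv s l v) = fmsHom s v := by
  have h := LinearEquiv.apply_symm_apply
    (LinearEquiv.ofInjective (barToN s l) (barToN_injective s l))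
    (LinearEquiv.ofEq _ _ (range_fmsHomCharge s l)
      (LinearEquiv.ofInjective (fmsHomCharge s l) (fmsHomCharge_injective s l) v))
  exact congrArg Subtype.val h

end FMS

end

theorem mainTheorem4 (s : ℂ) :
    (∀ m n : ℤ, FMS.gammaN s m * FMS.betaN s n =
      FMS.betaN s n * FMS.gammaN s m + if m = -n then 1 else 0) ∧
    (∀ m n : ℤ, FMS.betaN s m * FMS.betaN s n = FMS.betaN s n * FMS.betaN s m) ∧
    (∀ m n : ℤ, FMS.gammaN s m * FMS.gammaN s n = FMS.gammaN s n * FMS.gammaN s m) ∧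
    ∃ ε : FMS.BGFock →ₗ[ℂ] FMS.N s,
      FMS.IsFMSHom s ε ∧
      (∀ ε' : FMS.BGFock →ₗ[ℂ] FMS.N s, FMS.IsFMSHom s ε' → ε' = ε) ∧
      Function.Injective ε ∧
      LinearMap.range ε = LinearMap.ker (FMS.cZero s) ∧
      ∀ l : ℤ, ∃ Θ : FMS.bgCharge l ≃ₗ[ℂ]
          TensorProduct ℂ (FMS.barF l) (FMS.HeisFock (Complex.I * (s + l))),
        ∀ x : FMS.bgCharge l,
          ε x = DirectSum.lof ℂ ℤ (FMS.NComp s) l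
            (TensorProduct.map (FMS.barF l).subtype LinearMap.id (Θ x)) :=
  ⟨FMS.gammaN_betaN s, FMS.betaN_comm s, FMS.gammaN_comm s, FMS.fmsHom s, FMS.fmsHom_isFMSHom s,
    fun _ h => h.eq_fmsHom, FMS.fmsHom_injective s, FMS.range_fmsHom s,
    fun l => ⟨FMS.chargeEquiv s l, fun x => (FMS.barToN_chargeEquiv s l x).symm⟩⟩
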